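/- \textbf{Theorem.} For a permutation $\pi=(\pi(1),\dots,\pi(n))$ of $\{1,\dots,n\}$, $n\ge 1$, let $G(\pi)$ be the graph with vertex set $\{1,\dots,n\}$ in which $uv$ is an edge if and only if $(u-v)(\pi^{-1}(u)-\pi^{-1}(v))<0$, and let $m$ be its number of edges. An induced matching of a graph is a set $M$ of edges such that for any two distinct edges $u_1v_1,u_2v_2\in M$ none of $u_1u_2,u_1v_2,v_1u_2,v_1v_2$ is an edge of the graph; it is maximum if no induced matching has more edges. Given $\pi$, a maximum induced matching of $G(\pi)$ can be found in $\mathcal{O}(m+n)$ time. Precisely: there are one program for a random access machine (registers and a memory array of natural numbers; unit cost for each instruction: setting a constant, addition, truncated subtraction, multiplication, integer division, indirect load and store, jump, jump on zero, halt) and a constant $C$ such that, for every $n\ge 1$ and every permutation $\pi$ of $\{1,\dots,n\}$, the program, started with $n$ in a register, $\pi(1),\dots,\pi(n)$ in memory and $0$ everywhere else, halts after at most $C(m+n)$ steps with a list of the edges of a maximum induced matching of $G(\pi)$, without repetition, in memory; and throughout the computation every number held in a register or memory cell fits into a word of at most $C\cdot\ell(n)$ bits, where $\ell(n)=\lfloor\log_2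 n\rfloor+1$ is the length of $n$ in binary. -/

import Mathlib

/-! ## Permutation graphs and induced matchings -/

/-- The permutation graph `G(π)`. The vertex or position `i ∈ {1, …, n}` is represented by the
element of `Fin n` with value `i - 1`; `π.symm u` is the position of `u` in `π`. -/
def permutationGraph {n : ℕ} (π : Equiv.Perm (Fin n)) : SimpleGraph (Fin n) where
  Adj u v := ((u : ℤ) - (v : ℤ)) * (((π.symm u : Fin n) : ℤ) - ((π.symm v : Fin n) : ℤ)) < 0
  symm := ⟨fun u v h => by
    have e : ((v : ℤ) - (u : ℤ)) * (((π.symm v : Fin n) : ℤ) - ((π.symm u : Fin n) : ℤ)) =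
        ((u : ℤ) - (v : ℤ)) * (((π.symm u : Fin n) : ℤ) - ((π.symm v : Fin n) : ℤ)) := by ring
    rw [e]; exact h⟩
  loopless := ⟨fun u h => by simp at h⟩

/-- `M` is an induced matching of `G`: a set of edges such that no edge of `G` joins an endpoint
of one member of `M` to an endpoint of another. (Two distinct members sharing an endpoint are
excluded as well, since then the second endpoint of one is adjacent to the shared one.) -/
def IsInducedMatching {V : Type*} (G : SimpleGraph V) (M : Finset (Sym2 V)) : Prop :=
  (∀ e ∈ M, e ∈ G.edgeSet) ∧
    ∀ u₁ v₁ u₂ v₂ : V, s(u₁, v₁) ∈ M → s(u₂, v₂) ∈ M → s(u₁, v₁) ≠ s(u₂, v₂) →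
      ¬ G.Adj u₁ u₂ ∧ ¬ G.Adj u₁ v₂ ∧ ¬ G.Adj v₁ u₂ ∧ ¬ G.Adj v₁ v₂

/-- `M` is an induced matching of `G` of maximum cardinality. -/
def IsMaximumInducedMatching {V : Type*} (G : SimpleGraph V) (M : Finset (Sym2 V)) : Prop :=
  IsInducedMatching G M ∧ ∀ M' : Finset (Sym2 V), IsInducedMatching G M' → M'.card ≤ M.card

/-! ## The random access machine -/

namespace RAM

/-- Instructions of a random access machine with registers `R₀, R₁, …` and a memory
`A[0], A[1], …`, all of them holding natural numbers. -/
inductive Instr where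
  /-- `R_d := c` -/
  | const (d c : ℕ)
  /-- `R_d := R_a + R_b` -/
  | add (d a b : ℕ)
  /-- `R_d := max (R_a - R_b) 0` -/
  | sub (d a b : ℕ)
  /-- `R_d := R_a * R_b` -/
  | mul (d a b : ℕ)
  /-- `R_d := ⌊R_a / R_b⌋` (and `0` if `R_b = 0`) -/
  | div (d a b : ℕ)
  /-- `R_d := A[R_a]` -/
  | load (d a : ℕ)
  /-- `A[R_a] := R_b` -/
  | store (a b : ℕ)
  /-- go to instruction number `l` -/
  | jump (l : ℕ)
  /-- go to instruction number `l` if `R_a = 0`, otherwise to the next instruction -/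
  | jumpZero (a l : ℕ)
  /-- stop -/
  | halt

/-- A program is a finite list of instructions, numbered from `0`. -/
abbrev Program := List Instr

/-- A configuration: program counter, registers and memory. -/
structure Config where
  pc : ℕ
  reg : ℕ → ℕ
  mem : ℕ → ℕ

/-- Put `v` into register `d` and go to the next instruction. -/
def Config.setReg (c : Config) (d v : ℕ) : Config :=
  ⟨c.pc + 1, Function.update c.reg d v, c.mem⟩

/-- The effect of one instruction; `none` means that the machine stops. -/
def Instr.exec (c : Config) : Instr → Option Config
  | .const d k => some (c.setReg d k)
  | .add d a b => some (c.setReg d (c.reg a + c.reg b))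
  | .sub d a b => some (c.setReg d (c.reg a - c.reg b))
  | .mul d a b => some (c.setReg d (c.reg a * c.reg b))
  | .div d a b => some (c.setReg d (c.reg a / c.reg b))
  | .load d a => some (c.setReg d (c.mem (c.reg a)))
  | .store a b => some ⟨c.pc + 1, c.reg, Function.update c.mem (c.reg a) (c.reg b)⟩
  | .jump l => some ⟨l, c.reg, c.mem⟩
  | .jumpZero a l => some ⟨if c.reg a = 0 then l else c.pc + 1, c.reg, c.mem⟩
  | .halt => none

/-- One step of the program `P`; `none` if the machine has stopped, either at a `halt` or because
the program counter has left the program. -/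
def step (P : Program) (c : Config) : Option Config :=
  match P[c.pc]? with
  | none => none
  | some i => i.exec c

/-- The configuration after `t` steps (it no longer changes once the machine has stopped). -/
def run (P : Program) (c : Config) : ℕ → Config
  | 0 => c
  | t + 1 => (step P (run P c t)).getD (run P c t)

/-- The machine has stopped. -/
def Halted (P : Program) (c : Config) : Prop := step P c = none

/-- Every number held in the configuration fits into a word of `w` bits. -/
def Config.FitsIn (c : Config) (w : ℕ) : Prop :=
  (∀ i, c.reg i < 2 ^ w) ∧ ∀ a, c.mem a < 2 ^ w

/-- The initial configuration on input `π`: `R₀ = n`, `A[i] = π(i)` for `1 ≤ i ≤ n`, and all other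
registers and memory cells are `0`. -/
def initPerm {n : ℕ} (π : Equiv.Perm (Fin n)) : Config where
  pc := 0
  reg := fun i => if i = 0 then n else 0
  mem := fun a => if h : 1 ≤ a ∧ a ≤ n then (π ⟨a - 1, by omega⟩ : ℕ) + 1 else 0

/-- The configuration holds the edge set `M` as its output: `R₀` is the number `k` of edges, and
from address `b = R₁` on the memory lists the edges of `M`, each exactly once, the `i`-th one by
its two endpoints (numbers in `{1, …, n}`) in the cells `A[b + 2 i]` and `A[b + 2 i + 1]`. -/
def Config.Outputs {n : ℕ} (c : Config) (M : Finset (Sym2 (Fin n))) : Prop :=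
  ∃ l : List (Fin n × Fin n),
    (l.map fun p => s(p.1, p.2)).Nodup ∧
    (∀ e, e ∈ M ↔ e ∈ l.map fun p => s(p.1, p.2)) ∧
    c.reg 0 = l.length ∧
    ∀ (i : ℕ) (h : i < l.length),
      c.mem (c.reg 1 + 2 * i) = ((l[i]).1 : ℕ) + 1 ∧
      c.mem (c.reg 1 + 2 * i + 1) = ((l[i]).2 : ℕ) + 1

end RAM

/-!
Two points of a permutation, given by position and value, are non-adjacent in `G(π)` if and only if
one of them is to the left of and below the other. If two edges belong to an induced matching, then
both points of one of them are to the left of and below both points of the other. So induced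
matchings are chains of inversions, `HasChain` (`hasChain_card`,
`isInducedMatching_of_isChainList`), and a longest chain has to be found.

The positions `p` are swept from left to right. For each length `k` the program keeps the threshold
`β k`, the least possible greatest value of a chain of `k` inversions among the positions before
`p`; thus there is such a chain with all values less than `y` if and only if `β k < y`
(`IsFrontier`). When the value `v` at position `p` is read, the greatest length `g v` of a chain to
the left of and below `v` is found from the thresholds, and `α v = β (g v)` is stored together with
the last inversion of such a chain (`IsVertexData`). The new inversions are `w > v` with `w` seen
before. Such an inversion can extend a chain that lies to the left of `w` and below `v`. The point
that makes linear time possible (`hasChain_succ_iff`) is that only chains of the length `g w` need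
to be considered: if only a shorter chain lies below `v`, then its extension is no longer than the
longest chain to the left of and below `w`, which ends earlier and lower. And there is a chain of
length `g w` to the left of `w` and below `v` if and only if `α w < v`. So each inversion is treated
in constant time, by lowering `β (g w + 1)` to `w` if necessary.

The inversions `w > v` are enumerated by insertion sort, which takes constant time for each of them.
The search for `g v` in the thresholds is downwards from the greatest length, and the thresholds
passed on the way are values greater than `v`, hence also neighbours of `v`
(`IsFrontier.sub_le_leftInversions`). The stored inversions link the members of a longest chain,
which is listed at the end.

The machine program is written in a small structured language, whose commands are compiled to
instructions and for which rules of total correctness with a clock are proved (`Cmd.Ensures`).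
-/

namespace RAM

/-! ### A structured language for the machine -/

theorem run_add (P : Program) (c : Config) (s t : ℕ) :
    run P c (s + t) = run P (run P c s) t := by
  induction t with
  | zero => rfl
  | succ t ih => rw [← Nat.add_assoc, run, run, ih]

/-- Every number held in the configuration is less than `W`. -/
def Config.Below (W : ℕ) (c : Config) : Prop :=
  (∀ i, c.reg i < W) ∧ ∀ a, c.mem a < W

/-- `P` leads from `c` to `c'` in exactly `t` steps, all numbers staying below `W`. -/
def Reaches (P : Program) (W : ℕ) (c : Config) (t : ℕ) (c' : Config) : Prop :=
  run P c t = c' ∧ ∀ s ≤ t, (run P c s).Below W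

theorem Reaches.below {P : Program} {W : ℕ} {c c' : Config} {t : ℕ} (h : Reaches P W c t c') :
    c'.Below W := h.1 ▸ h.2 t le_rfl

theorem Reaches.trans {P : Program} {W : ℕ} {c c' c'' : Config} {s t : ℕ}
    (h : Reaches P W c s c') (h' : Reaches P W c' t c'') : Reaches P W c (s + t) c'' := by
  refine ⟨by rw [run_add, h.1, h'.1], fun u hu => ?_⟩
  rcases le_total u s with hus | hus
  · exact h.2 u hus
  · obtain ⟨v, rfl⟩ := Nat.exists_eq_add_of_le hus
    rw [run_add, h.1]
    exact h'.2 v (by omega)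

theorem Reaches.single {P : Program} {W : ℕ} {c c' : Config} {i : Instr}
    (hi : P[c.pc]? = some i) (hc : i.exec c = some c') (h : c.Below W) (h' : c'.Below W) :
    Reaches P W c 1 c' := by
  have e : run P c 1 = c' := by simp [run, step, hi, hc]
  refine ⟨e, fun s hs => ?_⟩
  interval_cases s
  · exact h
  · rw [e]; exact h'

theorem Config.Below.setReg {W o o' d v : ℕ} {r m : ℕ → ℕ} (h : (Config.mk o r m).Below W)
    (hv : v < W) : (Config.mk o' (Function.update r d v) m).Below W := by
  refine ⟨fun i => ?_, h.2⟩
  by_cases hi : i = d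
  · subst hi; simpa using hv
  · simpa [hi] using h.1 i

/-- Structured commands: single instructions, sequential composition, and conditionals and loops
guarded by a register being nonzero. -/
inductive Cmd where
  | op (i : Instr)
  | seq (c d : Cmd)
  | ifNonzero (a : ℕ) (c : Cmd)
  | whileNonzero (a : ℕ) (c : Cmd)

/-- The number of instructions to which a command is compiled. -/
def Cmd.size : Cmd → ℕ
  | .op _ => 1
  | .seq c d => c.size + d.size
  | .ifNonzero _ c => c.size + 1
  | .whileNonzero _ c => c.size + 2

/-- The instructions to which a command is compiled when the first of them has number `o`. -/
def Cmd.code : Cmd → ℕ → List Instr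
  | .op i, _ => [i]
  | .seq c d, o => c.code o ++ d.code (o + c.size)
  | .ifNonzero a c, o => .jumpZero a (o + (c.size + 1)) :: c.code (o + 1)
  | .whileNonzero a c, o => .jumpZero a (o + (c.size + 2)) :: (c.code (o + 1) ++ [.jump o])

/-- The program `P` contains the compiled command from instruction number `o` on. -/
def Cmd.At (P : List Instr) : Cmd → ℕ → Prop
  | .op i, o => P[o]? = some i
  | .seq c d, o => c.At P o ∧ d.At P (o + c.size)
  | .ifNonzero a c, o => P[o]? = some (.jumpZero a (o + (c.size + 1))) ∧ c.At P (o + 1)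
  | .whileNonzero a c, o => P[o]? = some (.jumpZero a (o + (c.size + 2))) ∧ c.At P (o + 1) ∧
      P[o + 1 + c.size]? = some (.jump o)

theorem Cmd.length_code (c : Cmd) (o : ℕ) : (c.code o).length = c.size := by
  induction c generalizing o with
  | op i => rfl
  | seq c d hc hd => simp [code, size, hc, hd]
  | ifNonzero a c hc => simp [code, size, hc]
  | whileNonzero a c hc => simp [code, size, hc]

/-- A compiled command may be placed anywhere in a program. -/
theorem Cmd.at_append (c : Cmd) (pre post : List Instr) :
    c.At (pre ++ c.code pre.length ++ post) pre.length := by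
  induction c generalizing pre post with
  | op i => simp [At, code]
  | seq c d hc hd =>
    refine ⟨?_, ?_⟩
    · simpa [code] using hc pre (d.code (pre.length + c.size) ++ post)
    · simpa [code, length_code] using hd (pre ++ c.code pre.length) post
  | ifNonzero a c hc =>
    refine ⟨by simp [code], ?_⟩
    have := hc (pre ++ [.jumpZero a (pre.length + (c.size + 1))]) post
    rw [List.length_append, List.length_singleton] at this
    simpa [code] using this
  | whileNonzero a c hc =>
    refine ⟨by simp [code], ?_, ?_⟩
    · have := hc (pre ++ [.jumpZero a (pre.length + (c.size + 2))]) (.jump pre.length :: post)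
      rw [List.length_append, List.length_singleton] at this
      simpa [code] using this
    · rw [List.getElem?_append_left (by simp [code, length_code]; omega),
        List.getElem?_append_right (by omega)]
      have e : pre.length + 1 + c.size - pre.length = c.size + 1 := by omega
      simp [code, e, length_code]

/-! ### Total correctness with a clock -/

/-- The memory made of the arrays `a 0, a 1, …`, each of length `N`, one after another. -/
def layout (N : ℕ) (a : ℕ → ℕ → ℕ) (x : ℕ) : ℕ := a (x / N) (x % N)

/-- Assign `x` to the `i`-th entry of the `j`-th array. -/
def assign (a : ℕ → ℕ → ℕ) (j i x : ℕ) : ℕ → ℕ → ℕ :=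
  Function.update a j (Function.update (a j) i x)

@[simp] theorem assign_same (a : ℕ → ℕ → ℕ) (j i x : ℕ) :
    assign a j i x j = Function.update (a j) i x := by simp [assign]

theorem assign_of_ne (a : ℕ → ℕ → ℕ) {j j' : ℕ} (i x : ℕ) (h : j' ≠ j) :
    assign a j i x j' = a j' := by simp [assign, h]

theorem layout_apply {N i : ℕ} (a : ℕ → ℕ → ℕ) (j : ℕ) (hi : i < N) :
    layout N a (j * N + i) = a j i := by
  have hN : 0 < N := by omega
  have h1 : (j * N + i) / N = j := by
    rw [mul_comm, Nat.mul_add_div hN, Nat.div_eq_of_lt hi, add_zero]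
  have h2 : (j * N + i) % N = i := by
    rw [mul_comm, Nat.mul_add_mod, Nat.mod_eq_of_lt hi]
  rw [layout, h1, h2]

theorem update_layout {N i : ℕ} (a : ℕ → ℕ → ℕ) (j x : ℕ) (hi : i < N) :
    Function.update (layout N a) (j * N + i) x = layout N (assign a j i x) := by
  have hN : 0 < N := by omega
  funext y
  by_cases hy : y = j * N + i
  · subst hy
    rw [layout_apply _ _ hi]
    simp
  · rw [Function.update_of_ne hy, layout, layout]
    by_cases hj : y / N = j
    · rw [hj, assign_same, Function.update_of_ne]
      intro h
      apply hy
      rw [← Nat.div_add_mod y N, hj, h, mul_comm]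
    · rw [assign_of_ne _ _ _ hj]

/-- Total correctness with a clock: started at time `t` with registers `r` and the arrays `a` (of
length `N`) in memory, the command `c` terminates, with time, registers and arrays satisfying `Q`,
and all numbers stay below `W`. -/
def Cmd.Ensures (N W : ℕ) (c : Cmd) (t : ℕ) (r : ℕ → ℕ) (a : ℕ → ℕ → ℕ)
    (Q : ℕ → (ℕ → ℕ) → (ℕ → ℕ → ℕ) → Prop) : Prop :=
  ∀ P o, c.At P o → (Config.mk o r (layout N a)).Below W →
    ∃ u r' a', Reaches P W ⟨o, r, layout N a⟩ u ⟨o + c.size, r', layout N a'⟩ ∧ Q (t + u) r' a'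

namespace Cmd.Ensures

variable {N W t : ℕ} {r : ℕ → ℕ} {a : ℕ → ℕ → ℕ} {Q : ℕ → (ℕ → ℕ) → (ℕ → ℕ → ℕ) → Prop}

theorem const {d x : ℕ} (hx : x < W) (h : Q (t + 1) (Function.update r d x) a) :
    Ensures N W (.op (.const d x)) t r a Q := fun _ _ hP hB =>
  ⟨1, _, _, .single hP rfl hB (hB.setReg hx), h⟩

theorem add {d x y : ℕ} (hx : r x + r y < W)
    (h : Q (t + 1) (Function.update r d (r x + r y)) a) :
    Ensures N W (.op (.add d x y)) t r a Q := fun _ _ hP hB =>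
  ⟨1, _, _, .single hP rfl hB (hB.setReg hx), h⟩

theorem sub {d x y : ℕ} (h : Q (t + 1) (Function.update r d (r x - r y)) a) :
    Ensures N W (.op (.sub d x y)) t r a Q := fun _ _ hP hB =>
  ⟨1, _, _, .single hP rfl hB (hB.setReg ((Nat.sub_le _ _).trans_lt (hB.1 x))), h⟩

theorem seq {c d : Cmd} (h : c.Ensures N W t r a fun t' r' a' => d.Ensures N W t' r' a' Q) :
    (Cmd.seq c d).Ensures N W t r a Q := by
  intro P o hP hB
  obtain ⟨u, r', a', h1, h2⟩ := h P o hP.1 hB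
  obtain ⟨u', r'', a'', h3, h4⟩ := h2 P _ hP.2 h1.below
  refine ⟨u + u', r'', a'', ?_, by rwa [← add_assoc]⟩
  have := h1.trans h3
  rwa [add_assoc] at this

theorem mono {c : Cmd} {Q' : ℕ → (ℕ → ℕ) → (ℕ → ℕ → ℕ) → Prop} (h : c.Ensures N W t r a Q')
    (hQ : ∀ t' r' a', Q' t' r' a' → Q t' r' a') : c.Ensures N W t r a Q := by
  intro P o hP hB
  obtain ⟨u, r', a', h1, h2⟩ := h P o hP hB
  exact ⟨u, r', a', h1, hQ _ _ _ h2⟩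

theorem ifNonzero {x : ℕ} {c : Cmd} (h0 : r x = 0 → Q (t + 1) r a)
    (h1 : r x ≠ 0 → c.Ensures N W (t + 1) r a Q) :
    (Cmd.ifNonzero x c).Ensures N W t r a Q := by
  intro P o hP hB
  by_cases hx : r x = 0
  · exact ⟨1, r, a, .single hP.1 (by simp [Instr.exec, hx, size]) hB hB, h0 hx⟩
  · obtain ⟨u, r', a', h2, h3⟩ := h1 hx P (o + 1) hP.2 hB
    have h4 : Reaches P W ⟨o, r, layout N a⟩ 1 ⟨o + 1, r, layout N a⟩ :=
      .single hP.1 (by simp [Instr.exec, hx]) hB hB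
    refine ⟨1 + u, r', a', ?_, by rwa [← add_assoc]⟩
    have := h4.trans h2
    rwa [show o + 1 + c.size = o + (Cmd.ifNonzero x c).size by simp [size]; omega] at this

/-- The rule for loops, with an invariant `I` that is indexed by a variant. -/
theorem whileNonzero {x k : ℕ} {c : Cmd} (I : ℕ → ℕ → (ℕ → ℕ) → (ℕ → ℕ → ℕ) → Prop)
    (hI : I k t r a)
    (hc : ∀ k t r a, I k t r a → r x ≠ 0 →
      c.Ensures N W (t + 1) r a fun t' r' a' => ∃ k' < k, I k' (t' + 1) r' a')
    (hQ : ∀ k t r a, I k t r a → r x = 0 → Q (t + 1) r a) :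
    (Cmd.whileNonzero x c).Ensures N W t r a Q := by
  intro P o hP hB
  induction k using Nat.strong_induction_on generalizing t r a with
  | _ k ih =>
    by_cases hx : r x = 0
    · exact ⟨1, r, a, .single hP.1 (by simp [Instr.exec, hx, size]) hB hB, hQ _ _ _ _ hI hx⟩
    · have h1 : Reaches P W ⟨o, r, layout N a⟩ 1 ⟨o + 1, r, layout N a⟩ :=
        .single hP.1 (by simp [Instr.exec, hx]) hB hB
      obtain ⟨u, r', a', h2, k', hk, h3⟩ := hc _ _ _ _ hI hx P (o + 1) hP.2.1 hB
      have h4 : Reaches P W ⟨o + 1 + c.size, r', layout N a'⟩ 1 ⟨o, r', layout N a'⟩ :=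
        .single hP.2.2 rfl h2.below h2.below
      obtain ⟨u', r'', a'', h5, h6⟩ := ih k' hk h3 h4.below
      refine ⟨1 + u + 1 + u', r'', a'', ((h1.trans h2).trans h4).trans h5, ?_⟩
      convert h6 using 1
      ring

end Cmd.Ensures

/-- `R_d := a j (R_i)`, where register `b` holds the address `j * N` of the `j`-th array. -/
def Cmd.read (d b i : ℕ) : Cmd := .seq (.op (.add d b i)) (.op (.load d d))

/-- `a j (R_i) := R_x`, where register `b` holds the address `j * N` of the `j`-th array;
register `17` is used for the address. -/
def Cmd.write (b i x : ℕ) : Cmd := .seq (.op (.add 17 b i)) (.op (.store 17 x))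

namespace Cmd.Ensures

variable {N W t : ℕ} {r : ℕ → ℕ} {a : ℕ → ℕ → ℕ} {Q : ℕ → (ℕ → ℕ) → (ℕ → ℕ → ℕ) → Prop}

theorem read {d b i j : ℕ} (hW : 8 * N ≤ W) (hb : r b = j * N) (hj : j ≤ 7) (hi : r i < N)
    (h : Q (t + 2) (Function.update r d (a j (r i))) a) :
    (Cmd.read d b i).Ensures N W t r a Q := by
  have hl : r b + r i < W := by
    have := Nat.mul_le_mul_right N hj
    omega
  refine seq (add hl fun P o hP hB => ?_)
  refine ⟨1, _, a, .single hP rfl hB (hB.setReg (hB.2 _)), ?_⟩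
  simpa [hb, layout_apply a j hi] using h

theorem write {b i x j : ℕ} (hW : 8 * N ≤ W) (hb : r b = j * N) (hj : j ≤ 7) (hi : r i < N)
    (hx : x ≠ 17)
    (h : Q (t + 2) (Function.update r 17 (j * N + r i)) (assign a j (r i) (r x))) :
    (Cmd.write b i x).Ensures N W t r a Q := by
  have hl : r b + r i < W := by
    have := Nat.mul_le_mul_right N hj
    omega
  refine seq (add hl fun P o hP hB => ?_)
  refine ⟨1, Function.update r 17 (j * N + r i), assign a j (r i) (r x), .single hP ?_ hB ?_, h⟩
  · simp [Instr.exec, size, hx, hb, update_layout a j (r x) hi]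
  · rw [← update_layout a j (r x) hi]
    refine ⟨fun y => ?_, fun y => ?_⟩
    · have := hB.1 y
      rwa [hb] at this
    · have h1 := hB.1 x
      have h2 := hB.2 y
      simp only [Function.update_of_ne hx] at h1
      simp only [Function.update_apply]
      split_ifs
      · exact h1
      · exact h2

end Cmd.Ensures

end RAM

/-! ### Chains of edges -/

/-- `f` is a permutation of `{1, …, n}` with inverse `pos`, both as functions on `ℕ`. -/
structure IsPermWithInverse (n : ℕ) (f pos : ℕ → ℕ) : Prop where
  map_mem : ∀ p, 1 ≤ p → p ≤ n → 1 ≤ f p ∧ f p ≤ n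
  pos_mem : ∀ v, 1 ≤ v → v ≤ n → 1 ≤ pos v ∧ pos v ≤ n
  pos_map : ∀ p, 1 ≤ p → p ≤ n → pos (f p) = p
  map_pos : ∀ v, 1 ≤ v → v ≤ n → f (pos v) = v

/-- `w > v` form an inversion; `pos` gives the positions of the values `1, …, n`. -/
def IsInversion (n : ℕ) (pos : ℕ → ℕ) (w v : ℕ) : Prop :=
  1 ≤ v ∧ v < w ∧ w ≤ n ∧ pos w < pos v

/-- There are `k` inversions, each of them to the left of and below the next one (both of its
points are less than both points of the next one in position and in value), the last of them having
positions less than `p` and values less than `y`. -/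
def HasChain (n : ℕ) (pos : ℕ → ℕ) : ℕ → ℕ → ℕ → Prop
  | 0, _, _ => True
  | k + 1, p, y => ∃ w v, IsInversion n pos w v ∧ pos v < p ∧ w < y ∧ HasChain n pos k (pos w) v

section Chains

variable {n : ℕ} {f pos : ℕ → ℕ} {k l p q y z w v : ℕ}

theorem HasChain.mono (h : HasChain n pos k p y) (hp : p ≤ q) (hy : y ≤ z) :
    HasChain n pos k q z := by
  cases k with
  | zero => trivial
  | succ k =>
    obtain ⟨w, v, h1, h2, h3, h4⟩ := h
    exact ⟨w, v, h1, by omega, by omega, h4⟩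

theorem HasChain.of_succ (h : HasChain n pos (k + 1) p y) : HasChain n pos k p y := by
  obtain ⟨w, v, ⟨h1, h2, h3, h4⟩, h5, h6, h7⟩ := h
  exact h7.mono (by omega) (by omega)

theorem HasChain.of_le (h : HasChain n pos k p y) (hl : l ≤ k) : HasChain n pos l p y := by
  induction k, hl using Nat.le_induction with
  | base => exact h
  | succ k _ ih => exact ih h.of_succ

/-- Each inversion of a chain uses two values of its own. Hence the thresholds fit into an array of
length `n + 1`, and so does the output. -/
theorem HasChain.two_mul_lt (h : HasChain n pos k p y) (hy : 1 ≤ y) : 2 * k < y := by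
  induction k generalizing p y with
  | zero => omega
  | succ k ih =>
    obtain ⟨w, v, ⟨h1, h2, h3, h4⟩, h5, h6, h7⟩ := h
    have := ih h7 h1
    omega

/-- The inversion `w > v` ends at a position less than `p`, and it is the last one of a chain of
`k` inversions, while there is no chain of `k` inversions to the left of and below `w`. -/
def IsLink (n : ℕ) (pos : ℕ → ℕ) (p k w v : ℕ) : Prop :=
  IsInversion n pos w v ∧ pos v < p ∧
    ∃ l, k = l + 1 ∧ HasChain n pos l (pos w) v ∧ ¬ HasChain n pos (l + 1) (pos w) w

theorem IsLink.mono (h : IsLink n pos p k w v) (hp : p ≤ q) : IsLink n pos q k w v :=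
  ⟨h.1, h.2.1.trans_le hp, h.2.2⟩

/-- What is computed for the point with value `w`: the greatest length `k` of a chain to the left
of and below this point, the least possible greatest value `x` in such a chain (`x = 0` if `k = 0`),
and the smaller value `z` of the last inversion of a chain attaining this minimum. -/
structure IsVertexData (n : ℕ) (pos : ℕ → ℕ) (w k x z : ℕ) : Prop where
  hasChain_iff : ∀ y, 1 ≤ y → y ≤ n + 1 → (HasChain n pos k (pos w) y ↔ x < y)
  lt : x < w
  not_hasChain : ¬ HasChain n pos (k + 1) (pos w) w
  isLink : k ≠ 0 → IsLink n pos (pos w) k x z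

/-- The thresholds `β k`, for `k ≤ T`, describe the predicate `X`, of which `X k y` says that there
is a chain of `k` inversions of a certain kind with values less than `y`; `β k = n + 1` stands for
infinity, and otherwise `β k > δ k` is the last inversion of a chain of `k` inversions. -/
structure IsThreshold (n : ℕ) (pos : ℕ → ℕ) (X : ℕ → ℕ → Prop) (p T : ℕ) (β δ : ℕ → ℕ) :
    Prop where
  iff : ∀ k y, 1 ≤ y → y ≤ n + 1 → (X k y ↔ k ≤ T ∧ β k < y)
  isLink : ∀ k, 1 ≤ k → k ≤ T → β k < n + 1 → IsLink n pos p k (β k) (δ k)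

/-- The thresholds for the chains among the first `p - 1` positions; `T` is the least length
that is not attained. -/
structure IsFrontier (n : ℕ) (pos : ℕ → ℕ) (p T : ℕ) (β δ : ℕ → ℕ) : Prop extends
    IsThreshold n pos (fun k y => HasChain n pos k p y) p T β δ where
  one_le : 1 ≤ T
  le : T ≤ n
  top : β T = n + 1
  lt_of_lt : ∀ k < T, β k < n + 1

/-- The value `w` occurs at a position less than `p`. -/
def Seen (n : ℕ) (pos : ℕ → ℕ) (p w : ℕ) : Prop := 1 ≤ w ∧ w ≤ n ∧ pos w < p

/-- `S 1 < S 2 < ⋯ < S (p - 1)` are the values at the first `p - 1` positions, and `S 0 = 0`. -/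
structure IsSortedPrefix (n : ℕ) (pos : ℕ → ℕ) (p : ℕ) (S : ℕ → ℕ) : Prop where
  zero : S 0 = 0
  strictMono : ∀ i j, i < j → j < p → S i < S j
  seen : ∀ i, 1 ≤ i → i < p → Seen n pos p (S i)
  exists_eq : ∀ w, Seen n pos p w → ∃ i, 1 ≤ i ∧ i < p ∧ S i = w

/-- The number of inversions whose second position is `p`. -/
def leftInversions (n : ℕ) (f pos : ℕ → ℕ) (p : ℕ) : ℕ :=
  ((Finset.Icc 1 n).filter fun w => pos w < p ∧ f p < w).card

/-- A strictly increasing sequence of values that form inversions with the value at position `p` is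
no longer than the number of these inversions. This is how the loops are paid for. -/
theorem sub_le_leftInversions {h : ℕ → ℕ} {i j : ℕ}
    (hS : ∀ x, i < x → x ≤ j → Seen n pos p (h x) ∧ f p < h x)
    (hinj : ∀ x x', i < x → x < x' → x' ≤ j → h x < h x') :
    j - i ≤ leftInversions n f pos p := by
  rw [← Nat.card_Ioc, leftInversions]
  refine Finset.card_le_card_of_injOn h (fun x hx => ?_) fun x hx x' hx' e => ?_
  · rw [Finset.mem_coe, Finset.mem_Ioc] at hx
    obtain ⟨⟨h1, h2, h3⟩, h4⟩ := hS x hx.1 hx.2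
    simp [h1, h2, h3, h4]
  · rw [Finset.mem_coe, Finset.mem_Ioc] at hx hx'
    rcases lt_trichotomy x x' with hlt | heq | hlt
    · have := hinj x x' hx.1 hlt hx'.2
      omega
    · exact heq
    · have := hinj x' x hx'.1 hlt hx.2
      omega

/-! ### One position of the sweep -/

namespace IsFrontier

variable {T : ℕ} {β δ : ℕ → ℕ}

theorem seen (h : IsFrontier n pos p T β δ) (hk : 1 ≤ k) (hkT : k < T) :
    Seen n pos p (β k) := by
  obtain ⟨⟨h1, h2, h3, h4⟩, h5, -⟩ := h.isLink k hk hkT.le (h.lt_of_lt k hkT)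
  exact ⟨by omega, by omega, by omega⟩

theorem zero (h : IsFrontier n pos p T β δ) : β 0 = 0 := by
  have := ((h.iff 0 1 le_rfl (by omega)).mp trivial).2
  omega

theorem strictMono (h : IsFrontier n pos p T β δ) (hkl : k < l) (hl : l ≤ T) : β k < β l := by
  rcases hl.eq_or_lt with rfl | hl
  · rw [h.top]
    exact h.lt_of_lt k hkl
  · obtain ⟨⟨h1, h2, h3, h4⟩, h5, m, h6, h7, -⟩ :=
      h.isLink l (by omega) hl.le (h.lt_of_lt l hl)
    have h8 : HasChain n pos k p (δ l) := (h7.of_le (by omega)).mono (by omega) le_rfl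
    have := ((h.iff k _ h1 (by omega)).mp h8).2
    omega

/-- What the search for the last threshold below a new value `v` finds is what has to be stored
for `v`. -/
theorem isVertexData (h : IsFrontier n pos p T β δ) (hv1 : 1 ≤ v) (hvn : v ≤ n) (hv : pos v = p)
    (hkT : k ≤ T) (hk : β k ≤ v) (hlt : ∀ l, k < l → l ≤ T → v < β l) :
    IsVertexData n pos v k (β k) (δ k) := by
  have hk' : k < T := by
    rcases hkT.eq_or_lt with rfl | h'
    · have := h.top
      omega
    · exact h'
  refine ⟨fun y h1 h2 => ?_, ?_, fun hc => ?_, fun h0 => ?_⟩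
  · rw [hv, h.iff k y h1 h2]
    simp [hkT]
  · refine hk.lt_of_ne fun e => ?_
    rcases Nat.eq_zero_or_pos k with rfl | h0
    · rw [h.zero] at e
      omega
    · have := (h.seen h0 hk').2.2
      rw [e] at this
      omega
  · rw [hv] at hc
    have h1 := (h.iff _ _ hv1 (by omega)).mp hc
    have := hlt (k + 1) (by omega) h1.1
    omega
  · rw [hv]
    exact h.isLink k (by omega) hkT (h.lt_of_lt k hk')

/-- The downward search from `T` for the last threshold below the new value is paid for by the
inversions of this value, since the thresholds passed on the way, except for `β T = n + 1`, are
different values seen before. -/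
theorem sub_le_leftInversions (h : IsFrontier n pos p T β δ)
    (hlt : ∀ l, k < l → l ≤ T → f p < β l) : T ≤ leftInversions n f pos p + k + 1 := by
  have := _root_.sub_le_leftInversions (n := n) (f := f) (pos := pos) (p := p) (h := β) (i := k)
    (j := T - 1) (fun x h1 h2 => ⟨h.seen (by omega) (by omega), hlt x h1 (by omega)⟩)
    (fun x x' h1 h2 h3 => h.strictMono h2 (by omega))
  omega

end IsFrontier

/-- The chains with positions less than `p`, or whose last inversion consists of `v` and one of the
values greater than `s` at these positions, for which the test `α w < v` succeeds. -/
def PartialChain (n : ℕ) (pos : ℕ → ℕ) (α g : ℕ → ℕ) (p v s k y : ℕ) : Prop :=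
  HasChain n pos k p y ∨ ∃ w, Seen n pos p w ∧ s < w ∧ k = g w + 1 ∧ α w < v ∧ w < y

/-- The key fact: for a new value `v` at position `p`, it suffices to extend the *longest* chains to
the left of and below the points `w` with which `v` forms inversions. If a chain below both `w` and
`v` is shorter than the longest one below `w`, extending it by the inversion `w > v` gives nothing
that was not there already. -/
theorem hasChain_succ_iff {α g γ : ℕ → ℕ} (hf : IsPermWithInverse n f pos) (hp : 1 ≤ p)
    (hpn : p ≤ n) (hd : ∀ w, Seen n pos p w → IsVertexData n pos w (g w) (α w) (γ w)) :
    HasChain n pos k (p + 1) y ↔ PartialChain n pos α g p (f p) (f p) k y := by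
  obtain ⟨hv1, hvn⟩ := hf.map_mem p hp hpn
  have hpv := hf.pos_map p hp hpn
  constructor
  · intro h
    cases k with
    | zero => exact .inl trivial
    | succ k =>
      obtain ⟨w, v, ⟨h1, h2, h3, h4⟩, h5, h6, h7⟩ := h
      rcases (Nat.lt_succ_iff.mp h5).eq_or_lt with h8 | h8
      · have hv : v = f p := by
          rw [← h8, hf.map_pos v h1 (by omega)]
        subst hv
        have hs : Seen n pos p w := ⟨by omega, h3, by omega⟩
        have hw := hd w hs
        rcases lt_trichotomy k (g w) with hk | hk | hk
        · refine .inl ?_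
          have h9 : HasChain n pos (g w) (pos w) w :=
            (hw.hasChain_iff w (by omega) (by omega)).mpr hw.lt
          exact (h9.of_le hk).mono (by omega) h6.le
        · subst hk
          exact .inr ⟨w, hs, h2, rfl, (hw.hasChain_iff _ h1 (by omega)).mp h7, h6⟩
        · exact absurd ((h7.of_le hk).mono le_rfl h2.le) hw.not_hasChain
      · exact .inl ⟨w, v, ⟨h1, h2, h3, h4⟩, h8, h6, h7⟩
  · rintro (h | ⟨w, hs, h1, rfl, h2, h3⟩)
    · exact h.mono (by omega) le_rfl
    · refine ⟨w, f p, ⟨hv1, h1, hs.2.1, ?_⟩, by omega, h3, ?_⟩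
      · rw [hpv]
        exact hs.2.2
      · exact ((hd w hs).hasChain_iff _ hv1 (by omega)).mpr h2

/-- Taking one more inversion `w > v` into account. -/
theorem IsThreshold.update {X : ℕ → ℕ → Prop} {T k x z : ℕ} {β δ : ℕ → ℕ}
    (h : IsThreshold n pos X p T β δ) (hw : IsVertexData n pos w k x z) (hwn : w ≤ n)
    (hv : 1 ≤ v) (hvw : v < w) (hpos : pos w < pos v) (hp : pos v < p) (hk : k + 1 ≤ T)
    (hxv : x < v) (hwβ : w < β (k + 1)) :
    IsThreshold n pos (fun l y => X l y ∨ (l = k + 1 ∧ w < y)) p T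
      (Function.update β (k + 1) w) (Function.update δ (k + 1) v) := by
  refine ⟨fun l y h1 h2 => ?_, fun l h1 h2 h3 => ?_⟩
  · rw [h.iff l y h1 h2]
    by_cases hl : l = k + 1
    · subst hl
      simp only [Function.update_self, true_and]
      omega
    · simp [hl]
  · by_cases hl : l = k + 1
    · subst hl
      simp only [Function.update_self]
      exact ⟨⟨hv, hvw, hwn, hpos⟩, hp, k, rfl,
        (hw.hasChain_iff v hv (by omega)).mpr hxv, hw.not_hasChain⟩
    · simp only [Function.update_of_ne hl] at h3 ⊢
      exact h.isLink l h1 h2 h3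

theorem IsThreshold.congr {X Y : ℕ → ℕ → Prop} {T : ℕ} {β δ : ℕ → ℕ}
    (h : IsThreshold n pos X p T β δ)
    (hXY : ∀ k y, 1 ≤ y → y ≤ n + 1 → (Y k y ↔ X k y)) : IsThreshold n pos Y p T β δ :=
  ⟨fun k y h1 h2 => (hXY k y h1 h2).trans (h.iff k y h1 h2), h.isLink⟩

theorem IsThreshold.mono {X : ℕ → ℕ → Prop} {T : ℕ} {β δ : ℕ → ℕ}
    (h : IsThreshold n pos X p T β δ) (hp : p ≤ q) : IsThreshold n pos X q T β δ :=
  ⟨h.iff, fun k h1 h2 h3 => (h.isLink k h1 h2 h3).mono hp⟩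

/-- If the greatest length was attained, a new greatest length is needed. -/
theorem IsThreshold.isFrontier_succ {T : ℕ} {β δ : ℕ → ℕ}
    (h : IsThreshold n pos (fun k y => HasChain n pos k p y) p T β δ)
    (h1 : 1 ≤ T) (hT : β T < n + 1) (hlt : ∀ k < T, β k < n + 1) :
    IsFrontier n pos p (T + 1) (Function.update β (T + 1) (n + 1)) δ := by
  have hc : HasChain n pos T p (n + 1) := (h.iff T _ (by omega) le_rfl).mpr ⟨le_rfl, hT⟩
  have := hc.two_mul_lt (by omega)
  refine ⟨⟨fun k y h2 h3 => ?_, fun k h2 h3 h4 => ?_⟩, by omega, by omega, by simp,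
    fun k hk => ?_⟩
  · rw [h.iff k y h2 h3]
    by_cases hk : k = T + 1
    · subst hk
      simp
      omega
    · simp only [Function.update_of_ne hk]
      omega
  · by_cases hk : k = T + 1
    · subst hk
      simp at h4
    · simp only [Function.update_of_ne hk] at h4 ⊢
      exact h.isLink k h2 (by omega) h4
  · rw [Function.update_of_ne (by omega)]
    rcases (Nat.lt_succ_iff.mp hk).eq_or_lt with rfl | hk
    · exact hT
    · exact hlt k hk

theorem isFrontier_one (hf : IsPermWithInverse n f pos) (hn : 1 ≤ n) {β δ : ℕ → ℕ}
    (h0 : β 0 = 0) (h1 : β 1 = n + 1) : IsFrontier n pos 1 1 β δ := by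
  refine ⟨⟨fun k y h2 h3 => ?_, fun k h2 h3 h4 => ?_⟩, le_rfl, hn, h1, fun k hk => ?_⟩
  · rcases k with - | k
    · exact iff_of_true trivial ⟨by omega, by omega⟩
    · refine iff_of_false ?_ fun h => ?_
      · rintro ⟨w, v, ⟨h4, h5, h6, h7⟩, h8, -⟩
        have := (hf.pos_mem v h4 (by omega)).1
        omega
      · obtain ⟨h4, h5⟩ := h
        have : k = 0 := by omega
        subst this
        rw [h1] at h5
        omega
  · have : k = 1 := by omega
    subst this
    omega
  · have : k = 0 := by omega
    subst this
    omega

theorem isSortedPrefix_one (hf : IsPermWithInverse n f pos) {S : ℕ → ℕ} (h0 : S 0 = 0) :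
    IsSortedPrefix n pos 1 S := by
  refine ⟨h0, fun i j h1 h2 => by omega, fun i h1 h2 => by omega, fun w hw => ?_⟩
  have := (hf.pos_mem w hw.1 hw.2.1).1
  have := hw.2.2
  omega

/-- Inserting the value at position `p` between `S i` and `S (i + 1)`. -/
theorem IsSortedPrefix.insert {S S' : ℕ → ℕ} {i : ℕ} (h : IsSortedPrefix n pos p S)
    (hf : IsPermWithInverse n f pos) (hp : 1 ≤ p) (hpn : p ≤ n)
    (hip : i < p) (hi : S i < f p) (hlt : ∀ j, i < j → j < p → f p < S j)
    (h1 : ∀ j ≤ i, S' j = S j) (h2 : S' (i + 1) = f p)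
    (h3 : ∀ j, i + 2 ≤ j → j ≤ p → S' j = S (j - 1)) : IsSortedPrefix n pos (p + 1) S' := by
  have hpv := hf.pos_map p hp hpn
  obtain ⟨hv1, hvn⟩ := hf.map_mem p hp hpn
  refine ⟨by rw [h1 0 (by omega), h.zero], fun j l hjl hl => ?_, fun j hj1 hj2 => ?_,
    fun w hw => ?_⟩
  · rcases lt_trichotomy l (i + 1) with hl1 | hl1 | hl1
    · rw [h1 j (by omega), h1 l (by omega)]
      exact h.strictMono j l hjl (by omega)
    · rw [hl1, h2, h1 j (by omega)]
      rcases (show j ≤ i by omega).eq_or_lt with rfl | hj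
      · exact hi
      · exact (h.strictMono j i hj (by omega)).trans hi
    · rw [h3 l (by omega) (by omega)]
      rcases lt_trichotomy j (i + 1) with hj1 | hj1 | hj1
      · rw [h1 j (by omega)]
        exact h.strictMono j _ (by omega) (by omega)
      · rw [hj1, h2]
        exact hlt _ (by omega) (by omega)
      · rw [h3 j (by omega) (by omega)]
        exact h.strictMono _ _ (by omega) (by omega)
  · rcases lt_trichotomy j (i + 1) with hj | hj | hj
    · rw [h1 j (by omega)]
      have := h.seen j hj1 (by omega)
      exact ⟨this.1, this.2.1, by have := this.2.2; omega⟩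
    · rw [hj, h2]
      exact ⟨hv1, hvn, by omega⟩
    · rw [h3 j (by omega) (by omega)]
      have := h.seen (j - 1) (by omega) (by omega)
      exact ⟨this.1, this.2.1, by have := this.2.2; omega⟩
  · rcases (Nat.lt_succ_iff.mp hw.2.2).eq_or_lt with he | he
    · refine ⟨i + 1, by omega, by omega, ?_⟩
      rw [h2, ← he, hf.map_pos w hw.1 hw.2.1]
    · obtain ⟨j, hj1, hj2, rfl⟩ := h.exists_eq w ⟨hw.1, hw.2.1, he⟩
      rcases Nat.lt_or_ge i j with hj | hj
      · exact ⟨j + 1, by omega, by omega, by rw [h3 _ (by omega) (by omega)]; simp⟩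
      · exact ⟨j, by omega, by omega, h1 j hj⟩

end Chains

/-! ### The program -/

/-! The arrays, with index `0, …, n`, are: `a 0 p`, the input; `a 1 i = S i`, the sorted list of the
values seen so far; `a 2 v = α v`, `a 3 v = γ v` and `a 4 v = g v`, the data `x`, `z`, `k` of
`IsVertexData`; `a 5 k = β k` and `a 6 k = δ k`, the thresholds of `IsFrontier`; `a 7`, the output.
Registers `1, …, 7` hold their addresses, registers `8` and `9` the constants `1` and `0`; register
`10` is the position `p`, register `11` the length `T`, register `12` the value `v` at position `p`.
Registers from `13` on are used locally. -/

namespace RAM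

/-- Sequential composition. -/
local infixr:60 " ;; " => Cmd.seq

/-- Search downwards for the last threshold `β k` that is at most the new value (register `12`),
starting with `k = T` (register `11`); `k` is left in register `13` and `β k` in register `14`. -/
def levelSearch : Cmd :=
  .op (.add 13 11 9) ;; .read 14 5 13 ;; .op (.sub 15 14 12) ;;
    .whileNonzero 15 (.op (.sub 13 13 8) ;; .read 14 5 13 ;; .op (.sub 15 14 12))

/-- Store the data of the new value. -/
def record : Cmd :=
  .write 2 12 14 ;; .read 16 6 13 ;; .write 3 12 16 ;; .write 4 12 13

/-- Lower the threshold for the inversion consisting of registers `14` and `12`, if this inversion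
extends a longest chain to the left of and below the value in register `14`. -/
def extend : Cmd :=
  .read 16 2 14 ;; .op (.sub 16 12 16) ;;
    .ifNonzero 16 (.read 16 4 14 ;; .op (.add 16 16 8) ;; .read 15 5 16 ;; .op (.sub 15 15 14) ;;
      .ifNonzero 15 (.write 5 16 14 ;; .write 6 16 12))

/-- Insert the new value into the sorted list of the previous ones; every greater value that is
shifted on the way forms an inversion with the new value. -/
def insertion : Cmd :=
  .op (.sub 13 10 8) ;; .read 14 1 13 ;; .op (.sub 15 14 12) ;;
    .whileNonzero 15 (.op (.add 16 13 8) ;; .write 1 16 14 ;; extend ;;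
      .op (.sub 13 13 8) ;; .read 14 1 13 ;; .op (.sub 15 14 12)) ;;
    .op (.add 13 13 8) ;; .write 1 13 12

/-- Increase `T` if the threshold `β T` has become finite. -/
def advance : Cmd :=
  .read 16 5 11 ;; .op (.sub 15 1 16) ;;
    .ifNonzero 15 (.op (.add 11 11 8) ;; .write 5 11 1)

/-- Compute the thresholds for all positions; the position is in register `10`. -/
def sweep : Cmd :=
  .whileNonzero 15 (.read 12 9 10 ;; levelSearch ;; record ;; insertion ;; advance ;;
    .op (.add 10 10 8) ;; .op (.sub 15 1 10))

/-- Set the base registers, and `β 1` to infinity. -/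
def setup : Cmd :=
  .op (.const 8 1) ;; .op (.add 1 0 8) ;; .op (.add 2 1 1) ;; .op (.add 3 2 1) ;;
    .op (.add 4 3 1) ;; .op (.add 5 4 1) ;; .op (.add 6 5 1) ;; .op (.add 7 6 1) ;;
    .op (.const 10 1) ;; .op (.const 11 1) ;; .write 5 11 1 ;; .op (.sub 15 1 10)

/-- List the inversions of a longest chain, from the last one to the first one. -/
def output : Cmd :=
  .op (.sub 0 11 8) ;; .read 14 5 0 ;; .read 12 6 0 ;; .op (.const 13 0) ;;
    .whileNonzero 14 (.write 7 13 14 ;; .op (.add 13 13 8) ;; .write 7 13 12 ;;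
      .op (.add 13 13 8) ;; .read 12 3 14 ;; .read 14 2 14) ;;
    .op (.add 1 7 9)

/-- The whole program. -/
def inducedMatching : Cmd := setup ;; sweep ;; output

/-! ### Correctness of the program -/

/-- Registers `1, …, 7` hold the addresses of the arrays, and registers `8` and `9` the constants
`1` and `0`. -/
structure IsBase (N : ℕ) (r : ℕ → ℕ) : Prop where
  array : ∀ j, 1 ≤ j → j ≤ 7 → r j = j * N
  one : r 8 = 1
  zero : r 9 = 0

theorem IsBase.of_eq {N : ℕ} {r r' : ℕ → ℕ} (h : IsBase N r)
    (hr : ∀ i, 1 ≤ i → i ≤ 9 → r' i = r i) : IsBase N r' :=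
  ⟨fun j h1 h2 => by rw [hr j h1 (by omega), h.array j h1 h2],
    by rw [hr 8 (by omega) (by omega), h.one],
    by rw [hr 9 (by omega) (by omega), h.zero]⟩

section Correctness

variable {n N W t p T : ℕ} {f pos r : ℕ → ℕ} {a : ℕ → ℕ → ℕ}

open Cmd.Ensures in
theorem levelSearch_ensures (hN : N = n + 1) (hW : 8 * N ≤ W) (hb : IsBase N r) (hT : r 11 = T)
    (hF : IsFrontier n pos p T (a 5) (a 6)) :
    levelSearch.Ensures N W t r a fun t' r' a' =>
      a' = a ∧ (∀ i ≤ 12, r' i = r i) ∧ ∃ k, r' 13 = k ∧ r' 14 = a 5 k ∧ k ≤ T ∧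
        a 5 k ≤ r 12 ∧ (∀ l, k < l → l ≤ T → r 12 < a 5 l) ∧ t' + 6 * k ≤ t + 5 + 6 * T := by
  have hTn := hF.le
  refine .seq (.add ?_ (.seq (.read (j := 5) hW ?_ (by omega) ?_ (.seq (.sub
    (.whileNonzero (k := T) (fun k t' r' a' => a' = a ∧ (∀ i ≤ 12, r' i = r i) ∧ r' 13 = k ∧
      r' 14 = a 5 k ∧ r' 15 = a 5 k - r 12 ∧ k ≤ T ∧ (∀ l, k < l → l ≤ T → r 12 < a 5 l) ∧
      t' + 6 * k ≤ t + 4 + 6 * T) ?_ ?_ ?_))))))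
  · rw [hT, hb.zero]
    omega
  · simp [hb.array]
  · simp [hT, hb.zero]
    omega
  · refine ⟨rfl, fun i hi => ?_, ?_, ?_, ?_, le_rfl, fun l h1 h2 => by omega, by omega⟩
    · simp [show i ≠ 13 by omega, show i ≠ 14 by omega,
        show i ≠ 15 by omega]
    all_goals simp [hT, hb.zero]
  · rintro k t' r' a' ⟨rfl, hr, h13, h14, h15, hk, hl, ht⟩ h0
    have hb' : IsBase N r' := hb.of_eq fun i _ _ => hr i (by omega)
    have hk0 : k ≠ 0 := by
      rintro rfl
      rw [h15, hF.zero] at h0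
      omega
    refine .seq (.sub (.seq (.read (j := 5) hW ?_ (by omega) ?_ (.sub
      ⟨k - 1, by omega, rfl, fun i hi => ?_, ?_, ?_, ?_, by omega, fun l h1 h2 => ?_, by omega⟩))))
    · simp [hb'.array]
    · simp [h13]
      omega
    · simp [show i ≠ 13 by omega, show i ≠ 14 by omega,
        show i ≠ 15 by omega, hr i hi]
    · simp [h13, hb'.one]
    · simp [h13, hb'.one]
    · simp [h13, hb'.one, hr 12]
    · rcases (show k ≤ l by omega).eq_or_lt with rfl | h3
      · omega
      · exact hl l h3 h2
  · rintro k t' r' a' ⟨rfl, hr, h13, h14, h15, hk, hl, ht⟩ h0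
    exact ⟨rfl, hr, k, h13, h14, hk, by omega, hl, by omega⟩

open Cmd.Ensures in
theorem record_ensures {k : ℕ} (hW : 8 * N ≤ W) (hb : IsBase N r) (hv : r 12 < N) (hk : r 13 < N)
    (hrk : r 13 = k) (hx : r 14 = a 5 k) :
    record.Ensures N W t r a fun t' r' a' =>
      (∀ i ≤ 12, r' i = r i) ∧ (∀ j, j ≠ 2 → j ≠ 3 → j ≠ 4 → a' j = a j) ∧
        a' 2 = Function.update (a 2) (r 12) (a 5 k) ∧
        a' 3 = Function.update (a 3) (r 12) (a 6 k) ∧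
        a' 4 = Function.update (a 4) (r 12) k ∧ t' = t + 8 := by
  refine .seq (.write (j := 2) hW ?_ (by omega) hv (by omega) (.seq (.read (j := 6) hW ?_ (by omega)
    ?_ (.seq (.write (j := 3) hW ?_ (by omega) ?_ (by omega) (.write (j := 4) hW ?_ (by omega) ?_
      (by omega) ⟨fun i hi => ?_, fun j h2 h3 h4 => ?_, ?_, ?_, ?_, rfl⟩))))))
  · simp [hb.array]
  · simp [hb.array]
  · simpa using hk
  · simp [hb.array]
  · simpa using hv
  · simp [hb.array]
  · simpa using hv
  · simp [show i ≠ 16 by omega, show i ≠ 17 by omega]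
  all_goals simp [assign_of_ne, *]

open Cmd.Ensures in
theorem extend_ensures {q v w : ℕ} {X : ℕ → ℕ → Prop} (hN : N = n + 1) (hW : 8 * N ≤ W)
    (hb : IsBase N r) (h12 : r 12 = v) (h14 : r 14 = w)
    (hw : IsVertexData n pos w (a 4 w) (a 2 w) (a 3 w)) (hwn : w ≤ n) (hv : 1 ≤ v) (hvw : v < w)
    (hpos : pos w < pos v) (hq : pos v < q) (hk : a 4 w + 1 ≤ T) (hT : T ≤ n)
    (hX : IsThreshold n pos X q T (a 5) (a 6)) :
    extend.Ensures N W t r a fun t' r' a' =>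
      (∀ i ≤ 14, r' i = r i) ∧ (∀ j, j ≠ 5 → j ≠ 6 → a' j = a j) ∧ (∀ k, a' 5 k ≤ a 5 k) ∧
        IsThreshold n pos (fun l y => X l y ∨ (l = a 4 w + 1 ∧ a 2 w < v ∧ w < y)) q T
          (a' 5) (a' 6) ∧ t' ≤ t + 15 := by
  refine .seq (.read (j := 2) hW ?_ (by omega) ?_ (.seq (.sub (.ifNonzero (fun h0 => ?_)
    fun h0 => .seq (.read (j := 4) hW ?_ (by omega) ?_ (.seq (.add ?_ (.seq (.read (j := 5) hW ?_
    (by omega) ?_ (.seq (.sub (.ifNonzero (fun h1 => ?_) fun h1 =>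
    .seq (.write (j := 5) hW ?_ (by omega) ?_ (by omega) (.write (j := 6) hW ?_ (by omega) ?_
      (by omega) ?_))))))))))))))
  · simp [hb.array]
  · omega
  · simp [h12, h14] at h0
    refine ⟨fun i hi => ?_, fun _ _ _ => rfl, fun _ => le_rfl, ?_, by omega⟩
    · simp [show i ≠ 16 by omega]
    · exact hX.congr fun l y _ _ => or_iff_left fun h => by omega
  · simp [hb.array]
  · simp
    omega
  · simp [h14, hb.one]
    omega
  · simp [hb.array]
  · simp [h14, hb.one]
    omega
  · simp [h14, hb.one] at h1
    -- a threshold that is at most `w` already covers the chains ending in the inversion `w > v`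
    refine ⟨fun i hi => ?_, fun _ _ _ => rfl, fun _ => le_rfl, ?_, by omega⟩
    · simp [show i ≠ 16 by omega, show i ≠ 15 by omega]
    · refine hX.congr fun l y hy hy' => or_iff_left_of_imp ?_
      rintro ⟨rfl, -, h⟩
      exact (hX.iff _ y hy hy').mpr ⟨hk, by omega⟩
  · simp [hb.array]
  · simp [h14, hb.one]
    omega
  · simp [hb.array]
  · simp [h14, hb.one]
    omega
  · simp [h12, h14] at h0
    simp [h14, hb.one] at h1
    refine ⟨fun i hi => ?_, fun j h5 h6 => ?_, fun k => ?_, ?_, by omega⟩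
    · simp [show i ≠ 16 by omega, show i ≠ 15 by omega, show i ≠ 17 by omega]
    · simp [assign_of_ne, h5, h6]
    · simp [assign_of_ne, h14, hb.one, Function.update_apply]
      split_ifs with h
      · rw [h]
        omega
      · exact le_rfl
    · simp only [assign_of_ne _ _ _ (show 5 ≠ 6 by omega), assign_same,
        assign_of_ne _ _ _ (show 6 ≠ 5 by omega)]
      simp [h14, h12, hb.one]
      refine (hX.update hw hwn hv hvw hpos hq hk (by omega) (by omega)).congr fun l y _ _ => ?_
      simp [show a 2 w < v by omega]

open Cmd.Ensures in
theorem insertion_ensures (hf : IsPermWithInverse n f pos) (hN : N = n + 1) (hW : 8 * N ≤ W)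
    (hb : IsBase N r) (h10 : r 10 = p) (hp : 1 ≤ p) (hpn : p ≤ n) (h12 : r 12 = f p)
    (hS : IsSortedPrefix n pos p (a 1))
    (hd : ∀ w, Seen n pos p w → IsVertexData n pos w (a 4 w) (a 2 w) (a 3 w))
    (hF : IsFrontier n pos p T (a 5) (a 6)) :
    insertion.Ensures N W t r a fun t' r' a' =>
      (∀ i ≤ 12, r' i = r i) ∧ (∀ j, j ≠ 1 → j ≠ 5 → j ≠ 6 → a' j = a j) ∧
        (∀ k, a' 5 k ≤ a 5 k) ∧ IsSortedPrefix n pos (p + 1) (a' 1) ∧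
        IsThreshold n pos (fun k y => HasChain n pos k (p + 1) y) (p + 1) T (a' 5) (a' 6) ∧
        t' ≤ t + 8 + 24 * leftInversions n f pos p := by
  obtain ⟨hv1, hvn⟩ := hf.map_mem p hp hpn
  have hpv := hf.pos_map p hp hpn
  have hTn := hF.le
  -- The invariant with `S 1, …, S i` still to be compared with the new value: the values that were
  -- passed are shifted by one place, and they have been taken into account in the thresholds.
  refine .seq (.sub (.seq (.read (j := 1) hW ?_ (by omega) ?_ (.seq (.sub (.seq
    (.whileNonzero (k := p - 1) (fun i t' r' a' => (∀ j ≤ 12, r' j = r j) ∧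
      (∀ j, j ≠ 1 → j ≠ 5 → j ≠ 6 → a' j = a j) ∧ (∀ k, a' 5 k ≤ a 5 k) ∧
      r' 13 = i ∧ r' 14 = a 1 i ∧ r' 15 = a 1 i - f p ∧ i < p ∧
      (∀ x ≤ i, a' 1 x = a 1 x) ∧ (∀ x, i + 2 ≤ x → x ≤ p → a' 1 x = a 1 (x - 1)) ∧
      (∀ j, i < j → j < p → f p < a 1 j) ∧
      IsThreshold n pos (PartialChain n pos (a 2) (a 4) p (f p) (a 1 i)) (p + 1) T (a' 5) (a' 6) ∧
      t' + 24 * i ≤ t + 4 + 24 * (p - 1)) ?_ ?_ ?_)))))))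
  · simp [hb.array]
  · simp [h10, hb.one]
    omega
  · refine ⟨fun j hj => ?_, fun _ _ _ _ => rfl, fun _ => le_rfl, ?_, ?_, ?_, by omega,
      fun _ _ => rfl, fun x _ _ => by omega, fun j _ _ => by omega, ?_, by omega⟩
    · simp [show j ≠ 13 by omega, show j ≠ 14 by omega, show j ≠ 15 by omega]
    · simp [h10, hb.one]
    · simp [h10, hb.one]
    · simp [h10, hb.one, h12]
    · refine (hF.toIsThreshold.mono (by omega)).congr fun k y _ _ => or_iff_left ?_
      rintro ⟨w, hw, h1, -⟩
      obtain ⟨i, hi1, hi2, rfl⟩ := hS.exists_eq w hw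
      rcases (show i ≤ p - 1 by omega).eq_or_lt with rfl | h2
      · omega
      · have := hS.strictMono i (p - 1) h2 (by omega)
        omega
  · rintro i t' r' a' ⟨hr, ha, hle, h13, h14, h15, hip, hS1, hS2, hgt, hX, ht⟩ h0
    have hb' : IsBase N r' := hb.of_eq fun i _ _ => hr i (by omega)
    have hr12 : r' 12 = f p := by rw [hr 12 le_rfl, h12]
    have hvi : f p < a 1 i := by omega
    have hi0 : i ≠ 0 := by
      rintro rfl
      rw [hS.zero] at hvi
      omega
    obtain ⟨hi1, hi2, hi3⟩ := hS.seen i (by omega) hip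
    have hwd := hd _ ⟨hi1, hi2, hi3⟩
    -- the longest chain to the left of and below a previous point is finite
    have hgT : a 4 (a 1 i) + 1 ≤ T := by
      have h1 : HasChain n pos (a 4 (a 1 i)) (pos (a 1 i)) n :=
        (hwd.hasChain_iff n (by omega) (by omega)).mpr (hwd.lt.trans_le hi2)
      have h2 := (hF.iff _ n (by omega) (by omega)).mp (h1.mono hi3.le le_rfl)
      have h3 : a 4 (a 1 i) ≠ T := by
        intro h3
        have := hF.top
        rw [h3] at h2
        omega
      omega
    refine .seq (.add ?_ (.seq (.write (j := 1) hW ?_ (by omega) ?_ (by omega) (.seq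
      ((extend_ensures (v := f p) (w := a 1 i) (T := T) (q := p + 1) (pos := pos)
        (X := PartialChain n pos (a 2) (a 4) p (f p) (a 1 i)) hN hW
        (hb'.of_eq fun j _ _ => ?_) ?_ ?_ ?_ hi2 hv1 hvi (by omega) (by omega) ?_ hTn ?_).mono ?_)))))
    · rw [h13, hb'.one]
      omega
    · simp [hb'.array]
    · simp [h13, hb'.one]
      omega
    · simp [show j ≠ 16 by omega, show j ≠ 17 by omega]
    · simp [hr12]
    · simp [h14]
    · simpa [assign_of_ne, ha] using hwd
    · simpa [assign_of_ne, ha] using hgT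
    · simpa only [assign_of_ne _ _ _ (show 5 ≠ 1 by omega),
        assign_of_ne _ _ _ (show 6 ≠ 1 by omega)] using hX
    · rintro t'' r'' a'' ⟨hr2, ha2, hle2, hX2, ht2⟩
      have hr2' : ∀ j ≤ 14, r'' j = r' j := fun j hj => by
        rw [hr2 j hj]
        simp [show j ≠ 16 by omega, show j ≠ 17 by omega]
      have hb'' : IsBase N r'' := hb'.of_eq fun i _ _ => hr2' i (by omega)
      have hS' : a'' 1 = Function.update (a' 1) (i + 1) (a 1 i) := by
        rw [ha2 1 (by omega) (by omega)]
        simp [h13, h14, hb'.one]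
      have hs : a'' 1 (i - 1) = a 1 (i - 1) := by
        rw [hS', Function.update_of_ne (by omega), hS1 _ (by omega)]
      have h13'' : r'' 13 = i := by rw [hr2' 13 (by omega), h13]
      have h12'' : r'' 12 = f p := by rw [hr2' 12 (by omega), hr12]
      refine .seq (.sub (.seq (.read (j := 1) hW ?_ (by omega) ?_ (.sub
        ⟨i - 1, by omega, fun j hj => ?_, fun j h1 h5 h6 => ?_, fun k => ?_, ?_, ?_, ?_, by omega,
          fun x hx => ?_, fun x h1 h2 => ?_, fun j h1 h2 => ?_, ?_, by omega⟩))))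
      · simp [hb''.array]
      · simp [h13'', hb''.one]
        omega
      · simp [show j ≠ 13 by omega, show j ≠ 14 by omega, show j ≠ 15 by omega, hr2' j (by omega),
          hr j hj]
      · rw [ha2 j h5 h6, assign_of_ne _ _ _ h1, ha j h1 h5 h6]
      · refine (hle2 k).trans ?_
        rw [assign_of_ne _ _ _ (by omega)]
        exact hle k
      · simp [h13'', hb''.one]
      · simp [h13'', hb''.one, hs]
      · simp [h13'', hb''.one, hs, h12'']
      · rw [hS', Function.update_of_ne (by omega), hS1 x (by omega)]
      · rw [hS']
        rcases (show i + 1 ≤ x by omega).eq_or_lt with rfl | h3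
        · simp
        · rw [Function.update_of_ne (by omega), hS2 x (by omega) h2]
      · rcases (show i ≤ j by omega).eq_or_lt with rfl | h3
        · exact hvi
        · exact hgt j h3 h2
      · refine hX2.congr fun k y _ _ => ?_
        simp only [assign_of_ne _ _ _ (show 4 ≠ 1 by omega),
          assign_of_ne _ _ _ (show 2 ≠ 1 by omega), ha 4 (by omega) (by omega) (by omega),
          ha 2 (by omega) (by omega) (by omega), PartialChain, or_assoc]
        refine or_congr_right ⟨?_, ?_⟩
        · rintro ⟨w, h1, h2, h3⟩
          obtain ⟨j, hj1, hj2, rfl⟩ := hS.exists_eq w h1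
          rcases lt_trichotomy i j with hij | rfl | hij
          · exact .inl ⟨a 1 j, h1, hS.strictMono _ _ hij hj2, h3⟩
          · exact .inr h3
          · rcases (show j ≤ i - 1 by omega).eq_or_lt with rfl | h4
            · omega
            · have := hS.strictMono j (i - 1) h4 (by omega)
              omega
        · have hlt := hS.strictMono (i - 1) i (by omega) hip
          rintro (⟨w, h1, h2, h3⟩ | h3)
          · exact ⟨w, h1, hlt.trans h2, h3⟩
          · exact ⟨_, ⟨hi1, hi2, hi3⟩, hlt, h3⟩
  · rintro i t' r' a' ⟨hr, ha, hle, h13, h14, h15, hip, hS1, hS2, hgt, hX, ht⟩ h0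
    have hb' : IsBase N r' := hb.of_eq fun i _ _ => hr i (by omega)
    have hr12 : r' 12 = f p := by rw [hr 12 le_rfl, h12]
    have hlt : a 1 i < f p := by
      refine lt_of_le_of_ne (by omega) fun e => ?_
      rcases Nat.eq_zero_or_pos i with rfl | hi
      · rw [hS.zero] at e
        omega
      · have := (hS.seen i hi hip).2.2
        rw [e] at this
        omega
    have hcount : p - 1 - i ≤ leftInversions n f pos p :=
      sub_le_leftInversions (h := a 1) (fun x h1 h2 =>
        ⟨hS.seen x (by omega) (by omega), hgt x h1 (by omega)⟩)
        fun x x' _ h2 h3 => hS.strictMono x x' h2 (by omega)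
    refine .seq (.add ?_ (.write (j := 1) hW ?_ (by omega) ?_ (by omega)
      ⟨fun j hj => ?_, fun j h1 h5 h6 => ?_, fun k => ?_, ?_, ?_, by omega⟩))
    · rw [h13, hb'.one]
      omega
    · simp [hb'.array]
    · simp [h13, hb'.one]
      omega
    · simp [show j ≠ 13 by omega, show j ≠ 17 by omega, hr j hj]
    · rw [assign_of_ne _ _ _ h1, ha j h1 h5 h6]
    · rw [assign_of_ne _ _ _ (by omega)]
      exact hle k
    · refine hS.insert hf hp hpn hip hlt hgt (fun j hj => ?_) ?_ fun j h1 h2 => ?_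
      · simp [h13, hb'.one, show j ≠ i + 1 by omega, hS1 j hj]
      · simp [h13, hb'.one, hr12]
      · simp [h13, hb'.one, show j ≠ i + 1 by omega, hS2 j h1 h2]
    · rw [assign_of_ne _ _ _ (by omega), assign_of_ne _ _ _ (by omega)]
      refine hX.congr fun k y _ _ => ?_
      rw [hasChain_succ_iff hf hp hpn hd]
      refine or_congr_right (exists_congr fun w => and_congr_right fun hw => and_congr_left' ?_)
      refine ⟨hlt.trans, fun h => ?_⟩
      obtain ⟨j, hj1, hj2, rfl⟩ := hS.exists_eq w hw
      rcases Nat.lt_or_ge i j with hij | hij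
      · exact hgt j hij hj2
      · rcases hij.eq_or_lt with rfl | hij
        · omega
        · have := hS.strictMono j i hij hip
          omega

open Cmd.Ensures in
theorem advance_ensures (hN : N = n + 1) (hW : 8 * N ≤ W) (hb : IsBase N r) (h11 : r 11 = T)
    (h1 : 1 ≤ T) (hTn : T ≤ n) (hT : a 5 T ≤ n + 1) (hlt : ∀ k < T, a 5 k < n + 1)
    (h : IsThreshold n pos (fun k y => HasChain n pos k p y) p T (a 5) (a 6)) :
    advance.Ensures N W t r a fun t' r' a' =>
      (∀ i ≤ 12, i ≠ 11 → r' i = r i) ∧ (∀ j, j ≠ 5 → a' j = a j) ∧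
        IsFrontier n pos p (r' 11) (a' 5) (a' 6) ∧ t' ≤ t + 7 := by
  have hr1 : r 1 = n + 1 := by rw [hb.array 1 (by omega) (by omega), hN, one_mul]
  refine .seq (.read (j := 5) hW ?_ (by omega) ?_ (.seq (.sub (.ifNonzero (fun h0 => ?_)
    fun h0 => .seq (.add ?_ (.write (j := 5) hW ?_ (by omega) ?_ (by omega) ?_))))))
  · simp [hb.array]
  · omega
  · simp [h11, hr1] at h0
    refine ⟨fun i hi hi' => ?_, fun _ _ => rfl, ?_, by omega⟩
    · simp [show i ≠ 15 by omega, show i ≠ 16 by omega]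
    · simp only [Function.update_of_ne (show 11 ≠ 15 by omega),
        Function.update_of_ne (show 11 ≠ 16 by omega), h11]
      exact ⟨h, h1, hTn, by omega, hlt⟩
  · simp [h11, hb.one]
    omega
  · simp [hb.array]
  · simp [h11, hr1] at h0
    have := h.isFrontier_succ h1 (by omega) hlt
    have := this.le
    simp [h11, hb.one]
    omega
  · simp [h11, hr1] at h0
    refine ⟨fun i hi hi' => ?_, fun j hj => assign_of_ne _ _ _ hj, ?_, by omega⟩
    · simp [show i ≠ 15 by omega, show i ≠ 16 by omega, show i ≠ 17 by omega, hi']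
    · rw [assign_same, assign_of_ne _ _ _ (by omega)]
      simp [h11, hb.one, hr1]
      exact h.isFrontier_succ h1 (by omega) hlt

/-- The invariant of the sweep before position `p`. -/
structure IsSwept (n : ℕ) (f pos : ℕ → ℕ) (p : ℕ) (r : ℕ → ℕ) (a : ℕ → ℕ → ℕ) : Prop where
  base : IsBase (n + 1) r
  position : r 10 = p
  input : ∀ q, 1 ≤ q → q ≤ n → a 0 q = f q
  sorted : IsSortedPrefix n pos p (a 1)
  data : ∀ w, Seen n pos p w → IsVertexData n pos w (a 4 w) (a 2 w) (a 3 w)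
  frontier : IsFrontier n pos p (r 11) (a 5) (a 6)

open Cmd.Ensures in
theorem sweep_ensures (hf : IsPermWithInverse n f pos) (hW : 8 * (n + 1) ≤ W)
    (h : IsSwept n f pos 1 r a) (h15 : r 15 = n) :
    sweep.Ensures (n + 1) W t r a fun t' r' a' => IsSwept n f pos (n + 1) r' a' ∧
      t' ≤ t + 1 + ∑ q ∈ Finset.Ico 1 (n + 1), (30 * leftInversions n f pos q + 40) := by
  refine .whileNonzero (k := n) (fun k t' r' a' => ∃ p, 1 ≤ p ∧ p + k = n + 1 ∧ r' 15 = k ∧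
    IsSwept n f pos p r' a' ∧
    t' ≤ t + ∑ q ∈ Finset.Ico 1 p, (30 * leftInversions n f pos q + 40)) ?_ ?_ ?_
  · exact ⟨1, le_rfl, by omega, h15, h, by simp⟩
  · rintro k t r a ⟨p, hp, hk, h15, h, ht⟩ h0
    obtain ⟨hb, h10, hin, hS, hd, hF⟩ := h
    have hpn : p ≤ n := by omega
    obtain ⟨hv1, hvn⟩ := hf.map_mem p hp hpn
    have hpv := hf.pos_map p hp hpn
    have hTn := hF.le
    refine .seq (.read (j := 0) hW ?_ (by omega) ?_ ?_)
    · simp [hb.zero]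
    · omega
    rw [h10, hin p hp hpn]
    have hb0 : IsBase (n + 1) (Function.update r 12 (f p)) :=
      hb.of_eq fun i _ _ => by simp [show i ≠ 12 by omega]
    refine .seq ((levelSearch_ensures rfl hW hb0 (by simp) hF).mono ?_)
    rintro t1 r1 a1 ⟨rfl, hr1, k1, h13, h14, hk1, hle1, hlt1, ht1⟩
    simp only [Function.update_self] at hle1 hlt1
    have hv : r1 12 = f p := by simp [hr1 12]
    have hT1 := hF.sub_le_leftInversions hlt1
    have hvd := hF.isVertexData hv1 hvn hpv hk1 hle1 hlt1
    refine .seq ((record_ensures hW (hb0.of_eq fun i _ _ => hr1 i (by omega)) (by omega) (by omega)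
      h13 h14).mono ?_)
    rintro t2 r2 a2 ⟨hr2, ha2, hα, hγ, hg, ht2⟩
    rw [hv] at hα hγ hg
    have hr2' : ∀ i ≤ 12, i ≠ 12 → r2 i = r i := fun i hi hi' => by
      rw [hr2 i hi, hr1 i hi, Function.update_of_ne hi']
    have hb2 : IsBase (n + 1) r2 := hb.of_eq fun i _ _ => hr2' i (by omega) (by omega)
    have hd2 : ∀ w, Seen n pos (p + 1) w → IsVertexData n pos w (a2 4 w) (a2 2 w) (a2 3 w) := by
      intro w hw
      rw [hα, hγ, hg]
      by_cases hwv : w = f p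
      · subst hwv
        simpa using hvd
      · simp only [Function.update_of_ne hwv]
        refine hd w ⟨hw.1, hw.2.1, lt_of_le_of_ne (Nat.lt_succ_iff.mp hw.2.2) fun e => hwv ?_⟩
        rw [← e, hf.map_pos w hw.1 hw.2.1]
    refine .seq ((insertion_ensures (T := r 11) hf rfl hW hb2 (p := p) ?_ hp hpn ?_ ?_ (fun w hw =>
      hd2 w ⟨hw.1, hw.2.1, hw.2.2.trans (Nat.lt_succ_self p)⟩) ?_).mono ?_)
    · rw [hr2' 10 (by omega) (by omega), h10]
    · rw [hr2 12 le_rfl, hv]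
    · rwa [ha2 1 (by omega) (by omega) (by omega)]
    · rwa [ha2 5 (by omega) (by omega) (by omega), ha2 6 (by omega) (by omega) (by omega)]
    rintro t3 r3 a3 ⟨hr3, ha3, hle3, hS3, hX3, ht3⟩
    rw [ha2 5 (by omega) (by omega) (by omega)] at hle3
    have hr3' : ∀ i ≤ 12, i ≠ 12 → r3 i = r i := fun i hi hi' => by
      rw [hr3 i hi, hr2' i hi hi']
    have hb3 : IsBase (n + 1) r3 := hb.of_eq fun i _ _ => hr3' i (by omega) (by omega)
    refine .seq ((advance_ensures rfl hW hb3 (hr3' 11 (by omega) (by omega)) hF.one_le hTn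
      ?_ (fun k hk => (hle3 k).trans_lt (hF.lt_of_lt k hk)) hX3).mono ?_)
    · exact (hle3 _).trans hF.top.le
    rintro t4 r4 a4 ⟨hr4, ha4, hF4, ht4⟩
    have hr4' : ∀ i ≤ 10, r4 i = r i := fun i hi => by
      rw [hr4 i (by omega) (by omega), hr3' i (by omega) (by omega)]
    have hb4 : IsBase (n + 1) r4 := hb.of_eq fun i _ _ => hr4' i (by omega)
    have h10' : r4 10 = p := by rw [hr4' 10 (by omega), h10]
    have h1' : r4 1 = n + 1 := by rw [hb4.array 1 (by omega) (by omega), one_mul]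
    refine .seq (.add ?_ (.sub ⟨k - 1, by omega, p + 1, by omega, by omega, ?_, ⟨?_, ?_, ?_, ?_,
      ?_, ?_⟩, ?_⟩))
    · rw [h10', hb4.one]
      omega
    · simp [h10', hb4.one, h1']
      omega
    · exact hb4.of_eq fun i _ _ => by simp [show i ≠ 10 by omega, show i ≠ 15 by omega]
    · simp [h10', hb4.one]
    · intro q hq hq'
      rw [ha4 0 (by omega), ha3 0 (by omega) (by omega) (by omega),
        ha2 0 (by omega) (by omega) (by omega), hin q hq hq']
    · rwa [ha4 1 (by omega)]
    · intro w hw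
      rw [ha4 4 (by omega), ha4 2 (by omega), ha4 3 (by omega),
        ha3 4 (by omega) (by omega) (by omega), ha3 2 (by omega) (by omega) (by omega),
        ha3 3 (by omega) (by omega) (by omega)]
      exact hd2 w hw
    · simpa using hF4
    · rw [Finset.sum_Ico_succ_top hp]
      omega
  · rintro k t' r' a' ⟨p, hp, hk, h15, h, ht⟩ h0
    have : p = n + 1 := by omega
    subst this
    exact ⟨h, by omega⟩

open Cmd.Ensures in
theorem setup_ensures (hf : IsPermWithInverse n f pos) (hn : 1 ≤ n) (hW : 8 * (n + 1) ≤ W)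
    (hr0 : r 0 = n) (hr : ∀ i, i ≠ 0 → r i = 0) (ha0 : ∀ q, 1 ≤ q → q ≤ n → a 0 q = f q)
    (ha : ∀ j i, 1 ≤ j → a j i = 0) :
    setup.Ensures (n + 1) W t r a fun t' r' a' =>
      IsSwept n f pos 1 r' a' ∧ r' 15 = n ∧ t' = t + 13 := by
  refine .seq <| .const (by omega) <| .seq <| .add ?_ <| .seq <| .add ?_ <| .seq <| .add ?_ <|
    .seq <| .add ?_ <| .seq <| .add ?_ <| .seq <| .add ?_ <| .seq <| .add ?_ <|
    .seq <| .const (by omega) <| .seq <| .const (by omega) <|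
    .seq <| .write (j := 5) hW ?_ (by omega) ?_ (by omega) <|
    .sub ⟨⟨⟨fun j h1 h2 => ?_, ?_, ?_⟩, ?_, fun q h1 h2 => ?_, ?_, fun w hw => ?_, ?_⟩, ?_, rfl⟩
  iterate 9
    · simp [hr0]
      omega
  · interval_cases j <;> simp [hr0] <;> ring
  · simp
  · simp [hr]
  · simp
  · rw [assign_of_ne _ _ _ (by omega), ha0 q h1 h2]
  · exact isSortedPrefix_one hf (by rw [assign_of_ne _ _ _ (by omega), ha _ _ le_rfl])
  · have := (hf.pos_mem w hw.1 hw.2.1).1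
    have := hw.2.2
    omega
  · refine isFrontier_one hf hn ?_ ?_
    · simp [ha]
    · simp [hr0]
  · simp [hr0]

/-- The inversions in the list `l` form a chain, from the last one to the first one. -/
def IsChainList (n : ℕ) (pos : ℕ → ℕ) (l : List (ℕ × ℕ)) : Prop :=
  (∀ e ∈ l, IsInversion n pos e.1 e.2) ∧ l.Pairwise fun e e' => pos e'.2 < pos e.1 ∧ e'.1 < e.2

open Cmd.Ensures in
theorem output_ensures (hW : 8 * (n + 1) ≤ W) (h : IsSwept n f pos (n + 1) r a) :
    output.Ensures (n + 1) W t r a fun t' r' a' => t' ≤ t + 8 + 6 * n ∧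
      ∃ l : List (ℕ × ℕ), IsChainList n pos l ∧ r' 0 = l.length ∧ r' 1 = 7 * (n + 1) ∧
        2 * l.length < n + 1 ∧
        (∀ (i : ℕ) (h : i < l.length), a' 7 (2 * i) = l[i].1 ∧ a' 7 (2 * i + 1) = l[i].2) ∧
        ∀ k, HasChain n pos k (n + 1) (n + 1) → k ≤ l.length := by
  obtain ⟨hb, -, -, -, hd, hF⟩ := h
  obtain ⟨T, hT⟩ : ∃ T, r 11 = T := ⟨_, rfl⟩
  rw [hT] at hF
  have hT1 := hF.one_le
  have hTn := hF.le
  have hK : 2 * (T - 1) < n + 1 := by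
    have h1 : HasChain n pos (T - 1) (n + 1) (n + 1) :=
      (hF.iff _ _ (by omega) le_rfl).mpr ⟨by omega, hF.lt_of_lt _ (by omega)⟩
    exact h1.two_mul_lt (by omega)
  refine .seq (.sub (.seq (.read (j := 5) hW ?_ (by omega) ?_ (.seq (.read (j := 6) hW ?_ (by omega)
    ?_ (.seq (.const (by omega) (.seq (.whileNonzero (k := T - 1) (fun k t' r' a' =>
      ∃ l : List (ℕ × ℕ), IsChainList n pos l ∧ l.length + k = T - 1 ∧
        (∀ j, 1 ≤ j → j ≤ 9 → r' j = r j) ∧ (∀ j, j ≠ 7 → a' j = a j) ∧ r' 0 = T - 1 ∧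
        r' 13 = 2 * l.length ∧
        (∀ (i : ℕ) (h : i < l.length), a' 7 (2 * i) = l[i].1 ∧ a' 7 (2 * i + 1) = l[i].2) ∧
        (k = 0 ∧ r' 14 = 0 ∨ IsLink n pos (n + 1) k (r' 14) (r' 12) ∧
          ∀ e ∈ l, pos (r' 12) < pos e.1 ∧ r' 14 < e.2) ∧
        t' + 12 * k ≤ t + 6 + 12 * (T - 1)) ?_ ?_ ?_)))))))))
  · simp [hb.array]
  · simp [hT, hb.one]
    omega
  · simp [hb.array]
  · simp [hT, hb.one]
    omega
  · refine ⟨[], ⟨by simp, by simp⟩, by simp, fun j h1 h2 => ?_, fun _ _ => rfl, ?_, by simp,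
      by simp, ?_, by omega⟩
    · simp [show j ≠ 13 by omega, show j ≠ 12 by omega, show j ≠ 14 by omega, show j ≠ 0 by omega]
    · simp [hT, hb.one]
    · simp [hT, hb.one]
      rcases Nat.eq_zero_or_pos (T - 1) with h0 | h0
      · exact .inl ⟨h0, by rw [h0, hF.zero]⟩
      · exact .inr (hF.isLink _ h0 (by omega) (hF.lt_of_lt _ (by omega)))
  · rintro k t' r' a' ⟨l, ⟨hl1, hl2⟩, hlen, hr, ha, h0, h13, hout, hlink, ht⟩ h14
    have hb' : IsBase (n + 1) r' := hb.of_eq hr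
    obtain ⟨w, hw⟩ : ∃ w, r' 14 = w := ⟨_, rfl⟩
    obtain ⟨v, hv⟩ : ∃ v, r' 12 = v := ⟨_, rfl⟩
    rw [hw] at h14
    rw [hw, hv] at hlink
    obtain ⟨⟨⟨hv1, hvw, hwn, hpos⟩, hvn, k, rfl, hc, hnc⟩, hl3⟩ :=
      hlink.resolve_left fun h => h14 h.2
    have hwd := hd w ⟨by omega, hwn, by omega⟩
    -- a link extends a longest chain to the left of and below `w`, so the data stored for `w`
    -- describe the rest of the chain
    have hg : a 4 w = k := by
      have h1 : HasChain n pos (a 4 w) (pos w) w :=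
        (hwd.hasChain_iff w (by omega) (by omega)).mpr hwd.lt
      rcases lt_trichotomy (a 4 w) k with h2 | h2 | h2
      · exact absurd ((hc.of_le h2).mono le_rfl hvw.le) hwd.not_hasChain
      · exact h2
      · exact absurd (h1.of_le h2) hnc
    have hα : a 2 w < v := (hwd.hasChain_iff v hv1 (by omega)).mp (hg ▸ hc)
    refine .seq <| .write (j := 7) hW ?_ (by omega) ?_ (by omega) <| .seq <| .add ?_ <|
      .seq <| .write (j := 7) hW ?_ (by omega) ?_ (by omega) <| .seq <| .add ?_ <|
      .seq <| .read (j := 3) hW ?_ (by omega) ?_ <| .read (j := 2) hW ?_ (by omega) ?_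
      ⟨k, by omega, l ++ [(w, v)], ⟨?_, ?_⟩, ?_, fun j h1 h2 => ?_, fun j hj => ?_, ?_, ?_, ?_, ?_,
        by omega⟩
    · simp [hb'.array]
    · omega
    · simp [h13, hb'.one]
      omega
    · simp [hb'.array]
    · simp [h13, hb'.one]
      omega
    · simp [h13, hb'.one]
      omega
    · simp [hb'.array]
    · simp [hw]
      omega
    · simp [hb'.array]
    · simp [hw]
      omega
    · intro e he
      rcases List.mem_append.mp he with he | he
      · exact hl1 e he
      · rw [List.mem_singleton] at he
        subst he
        exact ⟨hv1, hvw, hwn, hpos⟩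
    · refine List.pairwise_append.mpr ⟨hl2, List.pairwise_singleton _ _, fun e he e' he' => ?_⟩
      rw [List.mem_singleton] at he'
      subst he'
      exact hl3 e he
    · simp
      omega
    · simp [show j ≠ 14 by omega, show j ≠ 12 by omega, show j ≠ 13 by omega,
        show j ≠ 17 by omega, hr j h1 h2]
    · simp [assign_of_ne, hj, ha j hj]
    · simp [h0]
    · simp [h13, hb'.one]
      ring
    · intro i hi
      simp only [List.length_append, List.length_singleton] at hi
      simp [h13, hb'.one, hw, hv]
      rcases (show i ≤ l.length by omega).eq_or_lt with rfl | h1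
      · simp
      · have := hout i h1
        simp [show i ≠ l.length by omega, List.getElem_append_left h1,
          show 2 * i ≠ 2 * l.length + 1 by omega, show 2 * i + 1 ≠ 2 * l.length by omega, this]
    · simp [hw, assign_of_ne, ha]
      rcases Nat.eq_zero_or_pos k with rfl | hk
      · refine .inl ⟨rfl, ?_⟩
        have := (hwd.hasChain_iff 1 le_rfl (by omega)).mp (hg ▸ trivial)
        omega
      · refine .inr ?_
        have h1 := hwd.isLink (by omega)
        have h2 := h1.2.1
        rw [hg] at h1
        refine ⟨h1.mono (by omega), fun x y he => ?_⟩
        rcases he with he | ⟨rfl, rfl⟩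
        · have := hl3 _ he
          dsimp only at this
          omega
        · exact ⟨h2, hα⟩
  · rintro k t' r' a' ⟨l, hl, hlen, hr, ha, h0, h13, hout, hlink, ht⟩ h14
    have hb' : IsBase (n + 1) r' := hb.of_eq hr
    have hk : k = 0 := by
      rcases hlink with h | h
      · exact h.1
      · have := h.1.1.2.1
        omega
    subst hk
    refine .add ?_ ⟨by omega, l, hl, ?_, ?_, by omega, hout, fun k hk => ?_⟩
    · rw [hb'.array 7 (by omega) le_rfl, hb'.zero]
      omega
    · simp [h0]
      omega
    · simp [hb'.array, hb'.zero]
    · have h1 := (hF.iff k _ (by omega) le_rfl).mp hk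
      have h2 : k ≠ T := by
        rintro rfl
        have := hF.top
        omega
      omega

end Correctness

end RAM

/-! ### Inversions and the permutation graph -/

section Graph

variable {n : ℕ} (π : Equiv.Perm (Fin n))

/-- The permutation `π` of `{1, …, n}` as a function on `ℕ`. -/
def permFun (x : ℕ) : ℕ := (RAM.initPerm π).mem x

theorem permFun_succ (u : Fin n) : permFun π (u + 1) = π u + 1 := by
  have h : 1 ≤ (u : ℕ) + 1 ∧ (u : ℕ) + 1 ≤ n := ⟨by omega, u.isLt⟩
  simp only [permFun, RAM.initPerm, dif_pos h]
  rfl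

theorem exists_fin_succ {x : ℕ} (h1 : 1 ≤ x) (hn : x ≤ n) : ∃ u : Fin n, x = u + 1 :=
  ⟨⟨x - 1, by omega⟩, by simp only; omega⟩

theorem isPermWithInverse : IsPermWithInverse n (permFun π) (permFun π.symm) := by
  constructor
  all_goals
    intro x h1 hn
    obtain ⟨u, rfl⟩ := exists_fin_succ h1 hn
    simp only [permFun_succ, Equiv.symm_apply_apply, Equiv.apply_symm_apply]
    try omega

theorem adj_iff {u v : Fin n} : (permutationGraph π).Adj u v ↔
    IsInversion n (permFun π.symm) (u + 1) (v + 1) ∨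
      IsInversion n (permFun π.symm) (v + 1) (u + 1) := by
  simp only [permutationGraph, IsInversion, permFun_succ, mul_neg_iff]
  omega

/-- Two points one of which is to the left of and below the other are not adjacent. -/
theorem not_adj_of_lt {u v : Fin n} (h : u < v) (hp : π.symm u < π.symm v) :
    ¬ (permutationGraph π).Adj u v := by
  rw [adj_iff]
  simp only [IsInversion, permFun_succ]
  omega

theorem lt_iff_of_not_adj {u v : Fin n} (huv : u ≠ v) (h : ¬ (permutationGraph π).Adj u v) :
    u < v ↔ π.symm u < π.symm v := by
  have h1 : π.symm u ≠ π.symm v := π.symm.injective.ne huv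
  rw [adj_iff] at h
  simp only [IsInversion, permFun_succ] at h
  omega

/-- An induced matching, ordered by the greatest values, is a chain of inversions. -/
theorem hasChain_card {M : Finset (Sym2 (Fin n))} {p y : ℕ}
    (hM : IsInducedMatching (permutationGraph π) M)
    (hb : ∀ e ∈ M, ∀ x ∈ e, permFun π.symm (x + 1) < p ∧ (x : ℕ) + 1 < y) :
    HasChain n (permFun π.symm) M.card p y := by
  classical
  obtain ⟨k, hk⟩ : ∃ k, M.card = k := ⟨_, rfl⟩
  rw [hk]
  induction k generalizing M p y with
  | zero => trivial
  | succ k ih =>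
    have hordered : ∀ e ∈ M, ∃ w v : Fin n, e = s(w, v) ∧
        IsInversion n (permFun π.symm) (w + 1) (v + 1) := by
      intro e he
      induction e using Sym2.ind with
      | _ u v =>
        rcases (adj_iff π).mp (hM.1 _ he) with h | h
        · exact ⟨u, v, rfl, h⟩
        · exact ⟨v, u, Sym2.eq_swap, h⟩
    have hne : (Finset.univ.filter fun q : Fin n × Fin n => s(q.1, q.2) ∈ M ∧
        IsInversion n (permFun π.symm) (q.1 + 1) (q.2 + 1)).Nonempty := by
      obtain ⟨e, he⟩ := Finset.card_pos.mp (show 0 < M.card by omega)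
      obtain ⟨w, v, rfl, h⟩ := hordered e he
      exact ⟨(w, v), by simp [he, h]⟩
    -- the edge with the greatest endpoint is the last one of the chain
    obtain ⟨⟨w, v⟩, h1, h2⟩ := Finset.exists_max_image _ (fun q => q.1) hne
    simp only [Finset.mem_filter, Finset.mem_univ, true_and, Prod.forall] at h1 h2
    obtain ⟨hwM, hinv⟩ := h1
    refine ⟨w + 1, v + 1, hinv, (hb _ hwM v (by simp)).1, (hb _ hwM w (by simp)).2, ?_⟩
    have hcard : (M.erase s(w, v)).card = k := by
      rw [Finset.card_erase_of_mem hwM, hk, Nat.add_sub_cancel]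
    refine ih ⟨fun e he => hM.1 e (Finset.mem_of_mem_erase he), fun u₁ v₁ u₂ v₂ hu hv =>
      hM.2 u₁ v₁ u₂ v₂ (Finset.mem_of_mem_erase hu) (Finset.mem_of_mem_erase hv)⟩ ?_ hcard
    intro e he x hx
    obtain ⟨hne, he⟩ := Finset.mem_erase.mp he
    obtain ⟨w', v', rfl, hinv'⟩ := hordered e he
    have hle : w' ≤ w := h2 w' v' ⟨he, hinv'⟩
    obtain ⟨hww, hwv, hvw, hvv⟩ := hM.2 w' v' w v he hwM hne
    have hadj : (permutationGraph π).Adj w v := (adj_iff π).mpr (.inl hinv)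
    have hww' : w' ≠ w := by
      rintro rfl
      exact hwv hadj
    have hwv' : w' ≠ v := by
      rintro rfl
      exact hww hadj.symm
    have hvw' : v' ≠ w := by
      rintro rfl
      exact hvv hadj
    have hvv' : v' ≠ v := by
      rintro rfl
      exact hvw hadj.symm
    have e1 := lt_iff_of_not_adj π hww' hww
    have e2 := lt_iff_of_not_adj π hwv' hwv
    have e3 := lt_iff_of_not_adj π hvw' hvw
    have e4 := lt_iff_of_not_adj π hvv' hvv
    simp only [IsInversion, permFun_succ] at hinv hinv' ⊢
    rcases Sym2.mem_iff.mp hx with rfl | rfl <;> omega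

open RAM in
/-- A chain of inversions gives an induced matching. -/
theorem isInducedMatching_of_isChainList {l : List (Fin n × Fin n)}
    (hl : IsChainList n (permFun π.symm) (l.map fun e => ((e.1 : ℕ) + 1, (e.2 : ℕ) + 1))) :
    (l.map fun e => s(e.1, e.2)).Nodup ∧
      IsInducedMatching (permutationGraph π) (l.map fun e => s(e.1, e.2)).toFinset := by
  obtain ⟨h1, h2⟩ := hl
  rw [List.pairwise_map] at h2
  simp only [List.mem_map, forall_exists_index, and_imp, forall_apply_eq_imp_iff₂,
    permFun_succ] at h1 h2
  have hlt : l.Pairwise fun e e' => ∀ x ∈ s(e.1, e.2), ∀ x' ∈ s(e'.1, e'.2),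
      x' < x ∧ π.symm x' < π.symm x := by
    refine h2.imp_of_mem fun {e e'} he he' h x hx x' hx' => ?_
    have h3 := h1 e he
    have h4 := h1 e' he'
    simp only [IsInversion, permFun_succ] at h3 h4
    rcases Sym2.mem_iff.mp hx with rfl | rfl <;> rcases Sym2.mem_iff.mp hx' with rfl | rfl <;> omega
  refine ⟨?_, fun e he => ?_, ?_⟩
  · rw [List.nodup_iff_pairwise_ne, List.pairwise_map]
    refine hlt.imp fun {e e'} h heq => ?_
    exact lt_irrefl _ (h e.1 (by simp) e.1 (heq ▸ by simp)).1
  · rw [List.mem_toFinset, List.mem_map] at he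
    obtain ⟨e, he, rfl⟩ := he
    exact (adj_iff π).mpr (.inl (h1 e he))
  · have key : ∀ e ∈ l, ∀ e' ∈ l, s(e.1, e.2) ≠ s(e'.1, e'.2) → ∀ x ∈ s(e.1, e.2),
        ∀ x' ∈ s(e'.1, e'.2), ¬ (permutationGraph π).Adj x x' := by
      intro e he e' he' hne x hx x' hx'
      obtain ⟨i, hi, rfl⟩ := List.getElem_of_mem he
      obtain ⟨j, hj, rfl⟩ := List.getElem_of_mem he'
      rcases lt_trichotomy i j with hij | rfl | hij
      · have := List.pairwise_iff_getElem.mp hlt i j hi hj hij x hx x' hx'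
        exact fun h => not_adj_of_lt π this.1 this.2 h.symm
      · exact absurd rfl hne
      · have := List.pairwise_iff_getElem.mp hlt j i hj hi hij x' hx' x hx
        exact not_adj_of_lt π this.1 this.2
    intro u₁ v₁ u₂ v₂ hu hv hne
    simp only [List.mem_toFinset, List.mem_map] at hu hv
    obtain ⟨e, he, heq⟩ := hu
    obtain ⟨e', he', heq'⟩ := hv
    have := key e he e' he' (by rwa [heq, heq'])
    rw [heq, heq'] at this
    exact ⟨this _ (by simp) _ (by simp), this _ (by simp) _ (by simp), this _ (by simp) _ (by simp),
      this _ (by simp) _ (by simp)⟩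

/-- The costs of all positions together are bounded by the number of edges. -/
theorem sum_leftInversions_le :
    ∑ p ∈ Finset.Ico 1 (n + 1), leftInversions n (permFun π) (permFun π.symm) p ≤
      (permutationGraph π).edgeSet.ncard := by
  classical
  have hf := isPermWithInverse π
  rcases Nat.eq_zero_or_pos n with rfl | hn
  · simp
  simp only [leftInversions]
  rw [← Finset.card_sigma, ← Set.ncard_coe_finset]
  have : NeZero n := ⟨by omega⟩
  have hval : ∀ x, 1 ≤ x → x ≤ n → ((Fin.ofNat n (x - 1) : Fin n) : ℕ) + 1 = x := fun x h1 h2 => by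
    rw [Fin.val_ofNat, Nat.mod_eq_of_lt (by omega)]
    omega
  refine Set.ncard_le_ncard_of_injOn
    (fun q => s(Fin.ofNat n (q.2 - 1), Fin.ofNat n (permFun π q.1 - 1))) ?_ ?_ (Set.toFinite _)
  · rintro ⟨p, w⟩ h
    simp only [Finset.coe_sigma, Set.mem_sigma_iff, Finset.coe_Ico, Set.mem_Ico, Finset.mem_coe,
      Finset.mem_filter, Finset.mem_Icc] at h
    obtain ⟨⟨hp1, hp2⟩, ⟨hw1, hw2⟩, hpos, hlt⟩ := h
    obtain ⟨hv1, hv2⟩ := hf.map_mem p hp1 (by omega)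
    refine (adj_iff π).mpr (.inl ?_)
    simp only
    rw [hval _ hw1 hw2, hval _ hv1 hv2]
    exact ⟨hv1, hlt, hw2, by rwa [hf.pos_map p hp1 (by omega)]⟩
  · rintro ⟨p, w⟩ h ⟨p', w'⟩ h' heq
    simp only [Finset.coe_sigma, Set.mem_sigma_iff, Finset.coe_Ico, Set.mem_Ico, Finset.mem_coe,
      Finset.mem_filter, Finset.mem_Icc] at h h'
    obtain ⟨⟨hp1, hp2⟩, ⟨hw1, hw2⟩, hpos, hlt⟩ := h
    obtain ⟨⟨hp1', hp2'⟩, ⟨hw1', hw2'⟩, hpos', hlt'⟩ := h'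
    obtain ⟨hv1, hv2⟩ := hf.map_mem p hp1 (by omega)
    obtain ⟨hv1', hv2'⟩ := hf.map_mem p' hp1' (by omega)
    have e1 := hval w hw1 hw2
    have e2 := hval w' hw1' hw2'
    have e3 := hval _ hv1 hv2
    have e4 := hval _ hv1' hv2'
    rw [Sym2.eq_iff] at heq
    have e5 : w = w' ∧ permFun π p = permFun π p' := by
      rcases heq with ⟨h1, h2⟩ | ⟨h1, h2⟩
      · simp only at h1 h2
        rw [h1] at e1
        rw [h2] at e3
        omega
      · simp only at h1 h2
        rw [h1] at e1
        rw [h2] at e3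
        omega
    have e6 : p = p' := by
      rw [← hf.pos_map p hp1 (by omega), ← hf.pos_map p' hp1' (by omega), e5.2]
    rw [e6, e5.1]

end Graph

namespace RAM

theorem layout_self (N : ℕ) (m : ℕ → ℕ) : layout N (fun j i => m (j * N + i)) = m := by
  funext x
  rw [layout, mul_comm, Nat.div_add_mod]

theorem inducedMatching_ensures {n W : ℕ} (π : Equiv.Perm (Fin n)) (hn : 1 ≤ n)
    (hW : 8 * (n + 1) ≤ W) :
    inducedMatching.Ensures (n + 1) W 0 (initPerm π).reg
      (fun j i => (initPerm π).mem (j * (n + 1) + i)) fun t r a =>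
        t ≤ 68 * ((permutationGraph π).edgeSet.ncard + n) ∧
        ∃ l : List (ℕ × ℕ), IsChainList n (permFun π.symm) l ∧ r 0 = l.length ∧
        r 1 = 7 * (n + 1) ∧ 2 * l.length < n + 1 ∧
        (∀ (i : ℕ) (h : i < l.length), a 7 (2 * i) = l[i].1 ∧ a 7 (2 * i + 1) = l[i].2) ∧
        ∀ k, HasChain n (permFun π.symm) k (n + 1) (n + 1) → k ≤ l.length := by
  have hf := isPermWithInverse π
  refine .seq ((setup_ensures hf hn hW rfl (fun i hi => if_neg hi) (fun q _ _ => ?_)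
    fun j i hj => dif_neg fun h => ?_).mono ?_)
  · rw [zero_mul, zero_add]
    rfl
  · have := Nat.mul_le_mul_right (n + 1) hj
    omega
  rintro t r a ⟨h1, h15, ht⟩
  refine .seq ((sweep_ensures hf hW h1 h15).mono ?_)
  rintro t' r' a' ⟨h2, ht'⟩
  refine (output_ensures hW h2).mono ?_
  rintro t'' r'' a'' ⟨ht'', h3⟩
  refine ⟨?_, h3⟩
  have h4 := sum_leftInversions_le π
  rw [Finset.sum_add_distrib, ← Finset.mul_sum, Finset.sum_const, Nat.card_Ico] at ht'
  simp only [Nat.add_sub_cancel, smul_eq_mul] at ht'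
  omega

end RAM

theorem mainTheorem2 :
    ∃ (P : RAM.Program) (C : ℕ), ∀ (n : ℕ) (π : Equiv.Perm (Fin n)), 1 ≤ n →
      ∃ t ≤ C * ((permutationGraph π).edgeSet.ncard + n),
        RAM.Halted P (RAM.run P (RAM.initPerm π) t) ∧
        (∀ s ≤ t, (RAM.run P (RAM.initPerm π) s).FitsIn (C * Nat.size n)) ∧
        ∃ M : Finset (Sym2 (Fin n)),
          IsMaximumInducedMatching (permutationGraph π) M ∧
          (RAM.run P (RAM.initPerm π) t).Outputs M := by
  classical
  -- The constant comes from the running time; the numbers, all of them less than `8 * (n + 1)`,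
  -- have at most `3 + Nat.size n` bits.
  refine ⟨RAM.inducedMatching.code 0, 68, fun n π hn => ?_⟩
  have hW : 8 * (n + 1) ≤ 2 ^ (68 * Nat.size n) := by
    have h1 : n < 2 ^ Nat.size n := Nat.lt_size_self n
    have h2 : 1 ≤ Nat.size n := Nat.size_pos.mpr hn
    calc 8 * (n + 1) ≤ 2 ^ 3 * 2 ^ Nat.size n := by omega
      _ = 2 ^ (3 + Nat.size n) := (pow_add 2 3 _).symm
      _ ≤ _ := Nat.pow_le_pow_right (by omega) (by omega)
  have hat : RAM.inducedMatching.At (RAM.inducedMatching.code 0) 0 := by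
    simpa using RAM.inducedMatching.at_append [] []
  have hinit : RAM.Config.mk 0 (RAM.initPerm π).reg
      (RAM.layout (n + 1) fun j i => (RAM.initPerm π).mem (j * (n + 1) + i)) =
        RAM.initPerm π := by
    rw [RAM.layout_self]
    rfl
  obtain ⟨t, r, a, ⟨hrun, hbelow⟩, ht, l, hl, hr0, hr1, hlen, hout, hmax⟩ :=
    RAM.inducedMatching_ensures π hn hW (RAM.inducedMatching.code 0) 0 hat (by
      refine ⟨fun i => ?_, fun x => ?_⟩
      · simp only [RAM.initPerm]
        split_ifs <;> omega
      · rw [hinit]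
        simp only [RAM.initPerm]
        split_ifs with h
        · have := (π ⟨x - 1, by omega⟩).isLt
          omega
        · omega)
  rw [hinit] at hrun hbelow
  rw [zero_add] at ht
  obtain ⟨l, rfl⟩ : ∃ l' : List (Fin n × Fin n),
      l'.map (fun e => ((e.1 : ℕ) + 1, (e.2 : ℕ) + 1)) = l := by
    rw [← Set.mem_range, Set.range_list_map, Set.mem_ofPred_eq]
    intro e he
    obtain ⟨h1, h2, h3, -⟩ := hl.1 e he
    obtain ⟨u, hu⟩ := exists_fin_succ (show 1 ≤ e.1 by omega) h3
    obtain ⟨v, hv⟩ := exists_fin_succ h1 (show e.2 ≤ n by omega)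
    exact ⟨(u, v), Prod.ext hu.symm hv.symm⟩
  rw [List.length_map] at hr0 hlen hmax
  obtain ⟨hnodup, hM⟩ := isInducedMatching_of_isChainList π hl
  refine ⟨t, ht, ?_, hbelow, _, ⟨hM, fun M' hM' => ?_⟩, l, hnodup, fun e => List.mem_toFinset, ?_⟩
  · rw [hrun, RAM.Halted, RAM.step]
    simp [RAM.Cmd.length_code]
  · rw [List.toFinset_card_of_nodup hnodup, List.length_map]
    refine hmax _ (hasChain_card π hM' fun e _ x _ => ?_)
    have := (π.symm x).isLt
    rw [permFun_succ]
    omega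
  · rw [hrun]
    refine ⟨hr0, fun i hi => ?_⟩
    obtain ⟨h1, h2⟩ := hout i (by simpa using hi)
    simp only [hr1]
    rw [add_assoc, RAM.layout_apply a 7 (by omega), RAM.layout_apply a 7 (by omega), h1, h2]
    simp
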